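/- Let $A$ and $B$ be finite sets with $|A| \ge |B| \ge 2$, and let $\mathcal L=\{\exists,\forall,\wedge,\vee\}$. Let $(A;=_A)$ and $(B;=_B)$ be the structures in the signature with one binary relation symbol, interpreted as equality on $A$ and on $B$, respectively. An $\mathcal L$-sentence is a first-order sentence built from atomic formulas $R(x,y)$, where $R$ is the relation symbol and $x,y$ are variables, using only $\exists,\forall,\wedge,\vee$. Then every $\mathcal L$-sentence that is true in $(A;=_A)$ is also true in $(B;=_B)$, that is, this pair of structures is an $\mathcal L$-PMC template, and the promise model checking problem $\mathcal L\text{-}\mathrm{PMC}((A;=_A),(B;=_B))$ is $\mathrm{PSPACE}$-hard. Here the input of the problem is an $\mathcal L$-sentence $\phi$; it is a Yes-instance if $(A;=_A)\vDash\phi$ and a No-instance if $(B;=_B)\not\vDash\phi$. $\mathrm{PSPACE}$-hardness means that for every language $L$ in $\mathrm{PSPACE}$ over a finite alphabet there is a function $f$, computable in logarithmic space, such that $f(w)$ is a Yes-instance for each word $w\in L$ and $f(w)$ is a No-instance for each word $w\notin L$. -/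

import Mathlib

namespace PromiseMC

/-! ### Machines and space complexity -/

/-- Moves of a tape head. -/
inductive Move
  | left
  | stay
  | right

/-- Moving a head on a one-way infinite tape with cells `0, 1, 2, …`; a left move on cell `0` has no
effect. -/
def Move.apply : Move → ℕ → ℕ
  | .left, p => p - 1
  | .stay, p => p
  | .right, p => p + 1

/-- A deterministic single-tape Turing machine with input alphabet `α`. The tape is one-way infinite.
The machine halts when `δ` is undefined (`none`), and accepts iff it then is in a state
from `accept`. -/
structure TM (α : Type) where
  Q : Type
  Γ : Type
  finQ : Finite Q
  finΓ : Finite Γ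
  blank : Γ
  inp : α ↪ Γ
  inp_ne_blank : ∀ a, inp a ≠ blank
  start : Q
  accept : Set Q
  δ : Q → Γ → Option (Q × Γ × Move)

namespace TM

variable {α : Type} (M : TM α)

structure Cfg where
  state : M.Q
  head : ℕ
  tape : ℕ → M.Γ

/-- The input word stands on the leftmost cells, all other cells are blank, and the head is on
cell `0`. -/
def init (w : List α) : M.Cfg where
  state := M.start
  head := 0
  tape := fun i => (w[i]?).elim M.blank M.inp

/-- One step; `none` means that the machine has halted. -/
def step (c : M.Cfg) : Option M.Cfg :=
  (M.δ c.state (c.tape c.head)).map fun r =>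
    { state := r.1
      head := r.2.2.apply c.head
      tape := Function.update c.tape c.head r.2.1 }

/-- `M` halts on every input and accepts exactly the words of `L`. -/
def Decides (L : _root_.Language α) : Prop :=
  ∀ w : List α, ∃ c : M.Cfg,
    StateTransition.Reaches M.step (M.init w) c ∧ M.step c = none ∧ (c.state ∈ M.accept ↔ w ∈ L)

/-- On every input of length `n`, only cells among the first `s n` ones are ever scanned. -/
def RunsInSpace (s : ℕ → ℕ) : Prop :=
  ∀ (w : List α) (c : M.Cfg),
    StateTransition.Reaches M.step (M.init w) c → c.head < s w.length

end TM

/-- The class PSPACE: decidable by a deterministic Turing machine in polynomial space. -/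
def InPSPACE {α : Type} (L : _root_.Language α) : Prop :=
  ∃ (M : TM α) (p : Polynomial ℕ), M.Decides L ∧ M.RunsInSpace fun n => p.eval n

/-- What a read-only input tape shows: an input letter or one of the two end markers. -/
inductive InSym (α : Type)
  | leftEnd
  | letter (a : α)
  | rightEnd

/-- A deterministic Turing transducer with a two-way read-only input tape, `k` read-write work tapes
(one-way infinite), and a write-only output tape. In one step it reads the scanned input symbol and
the scanned symbols of the work tapes, and either halts (`none`) or changes its state, moves the input
head, writes on and moves on every work tape, and writes at most one letter to the output. -/
structure Transducer (α β : Type) where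
  k : ℕ
  Q : Type
  Γ : Type
  finQ : Finite Q
  finΓ : Finite Γ
  blank : Γ
  start : Q
  δ : Q → InSym α → (Fin k → Γ) → Option (Q × Move × (Fin k → Γ × Move) × Option β)

namespace Transducer

variable {α β : Type} (M : Transducer α β)

structure Cfg where
  state : M.Q
  inHead : ℕ
  heads : Fin M.k → ℕ
  tapes : Fin M.k → ℕ → M.Γ
  out : List β

/-- The input tape holds the left end marker on cell `0`, the word `w` on the cells `1, …, |w|` and the
right end marker on cell `|w| + 1`. -/
def readInput (w : List α) : ℕ → InSym α
  | 0 => .leftEnd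
  | i + 1 => (w[i]?).elim .rightEnd .letter

def init : M.Cfg where
  state := M.start
  inHead := 0
  heads := fun _ => 0
  tapes := fun _ _ => M.blank
  out := []

/-- One step on input `w`; `none` means that the machine has halted. The input head never leaves the
cells `0, …, |w| + 1`. -/
def step (w : List α) (c : M.Cfg) : Option M.Cfg :=
  (M.δ c.state (readInput w c.inHead) fun i => c.tapes i (c.heads i)).map fun r =>
    { state := r.1
      inHead := min (r.2.1.apply c.inHead) (w.length + 1)
      heads := fun i => (r.2.2.1 i).2.apply (c.heads i)
      tapes := fun i => Function.update (c.tapes i) (c.heads i) (r.2.2.1 i).1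
      out := c.out ++ r.2.2.2.toList }

/-- On every input `w`, the transducer halts with output `f w`. -/
def Computes (f : List α → List β) : Prop :=
  ∀ w : List α, ∃ c : M.Cfg,
    StateTransition.Reaches (M.step w) M.init c ∧ M.step w c = none ∧ c.out = f w

/-- On every input of length `n`, only cells among the first `s n` ones of each work tape are ever
scanned. -/
def RunsInSpace (s : ℕ → ℕ) : Prop :=
  ∀ (w : List α) (c : M.Cfg),
    StateTransition.Reaches (M.step w) M.init c → ∀ i, c.heads i < s w.length

end Transducer

/-- `f` is computable in logarithmic space. -/
def LogspaceComputable {α β : Type} (f : List α → List β) : Prop :=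
  ∃ (M : Transducer α β) (C : ℕ),
    M.Computes f ∧ M.RunsInSpace fun n => C * (Nat.log 2 n + 1)

/-- A promise problem over the alphabet `β`, given by its Yes-instances and its No-instances. -/
structure PromiseProblem (β : Type) where
  yes : Set (List β)
  no : Set (List β)

/-- Every language in PSPACE reduces to `P` by a logarithmic space many-one reduction, which maps
members to Yes-instances and non-members to No-instances. -/
def PromiseProblem.PSPACEHard {β : Type} (P : PromiseProblem β) : Prop :=
  ∀ (α : Type) [Finite α] (L : _root_.Language α), InPSPACE L →
    ∃ f : List α → List β, LogspaceComputable f ∧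
      ∀ w : List α, (w ∈ L → f w ∈ P.yes) ∧ (w ∉ L → f w ∈ P.no)

/-! ### The `{∃,∀,∧,∨}`-fragment of first-order logic -/

/-- `{∃,∀,∧,∨}`-formulas in the relation symbols of `σ`, with variables `x₀, x₁, x₂, …`. There is no
logical equality symbol: all atomic formulas are `R(x_{v 0}, …, x_{v (n-1)})`. -/
inductive Formula (σ : FirstOrder.Language.{0, 0}) : Type
  | rel {n : ℕ} (R : σ.Relations n) (v : Fin n → ℕ) : Formula σ
  | and (φ ψ : Formula σ) : Formula σ
  | or (φ ψ : Formula σ) : Formula σ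
  | ex (x : ℕ) (φ : Formula σ) : Formula σ
  | all (x : ℕ) (φ : Formula σ) : Formula σ

/-- The letters used to write formulas. -/
inductive Letter (σ : FirstOrder.Language.{0, 0}) : Type
  | rel {n : ℕ} (R : σ.Relations n) : Letter σ
  | and : Letter σ
  | or : Letter σ
  | ex : Letter σ
  | all : Letter σ
  | stroke : Letter σ
  | var : Letter σ

/-- The variable `xᵢ` is written as `i` strokes followed by the letter `var`. -/
def encodeVar {σ : FirstOrder.Language.{0, 0}} (i : ℕ) : List (Letter σ) :=
  List.replicate i Letter.stroke ++ [Letter.var]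

namespace Formula

variable {σ : FirstOrder.Language.{0, 0}}

/-- Formulas as words, in prefix notation. -/
def encode : Formula σ → List (Letter σ)
  | rel R v => Letter.rel R :: (List.ofFn fun i => encodeVar (v i)).flatten
  | and φ ψ => Letter.and :: (encode φ ++ encode ψ)
  | or φ ψ => Letter.or :: (encode φ ++ encode ψ)
  | ex x φ => Letter.ex :: (encodeVar x ++ encode φ)
  | all x φ => Letter.all :: (encodeVar x ++ encode φ)

def freeVars : Formula σ → Set ℕ
  | rel _ v => Set.range v
  | and φ ψ => freeVars φ ∪ freeVars ψ
  | or φ ψ => freeVars φ ∪ freeVars ψ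
  | ex x φ => freeVars φ \ {x}
  | all x φ => freeVars φ \ {x}

def IsSentence (φ : Formula σ) : Prop := φ.freeVars = ∅

/-- Satisfaction under an evaluation `ε` of the variables. -/
def Holds {A : Type*} [σ.Structure A] : Formula σ → (ℕ → A) → Prop
  | rel R v, ε => FirstOrder.Language.Structure.RelMap R fun i => ε (v i)
  | and φ ψ, ε => Holds φ ε ∧ Holds ψ ε
  | or φ ψ, ε => Holds φ ε ∨ Holds ψ ε
  | ex x φ, ε => ∃ a : A, Holds φ (Function.update ε x a)
  | all x φ, ε => ∀ a : A, Holds φ (Function.update ε x a)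

/-- Truth in `A`; used for sentences, whose satisfaction does not depend on the evaluation. -/
def TrueIn (A : Type*) [σ.Structure A] (φ : Formula σ) : Prop :=
  ∀ ε : ℕ → A, φ.Holds ε

end Formula

/-! ### Promise model checking -/

/-- Every sentence that is true in `A` is true in `B`. -/
def IsTemplate (σ : FirstOrder.Language.{0, 0}) (A B : Type*) [σ.Structure A] [σ.Structure B] : Prop :=
  ∀ φ : Formula σ, φ.IsSentence → φ.TrueIn A → φ.TrueIn B

/-- The promise model checking problem: given a sentence, answer Yes if it is true in `A`
and No if it is not true in `B`. -/
def PMC (σ : FirstOrder.Language.{0, 0}) (A B : Type*) [σ.Structure A] [σ.Structure B] :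
    PromiseProblem (Letter σ) where
  yes := {w | ∃ φ : Formula σ, φ.IsSentence ∧ φ.TrueIn A ∧ φ.encode = w}
  no := {w | ∃ φ : Formula σ, φ.IsSentence ∧ ¬ φ.TrueIn B ∧ φ.encode = w}

/-- A single relation symbol, which is binary. -/
inductive EqRel : ℕ → Type
  | eq : EqRel 2

/-- The signature with a single binary relation symbol. -/
def eqLang : FirstOrder.Language.{0, 0} where
  Functions := fun _ => Empty
  Relations := EqRel

/-- The structure `(A; =_A)`. -/
instance eqStructure (A : Type*) : eqLang.Structure A where
  funMap := fun f => nomatch f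
  RelMap := fun {_} R => match R with
    | EqRel.eq => fun v => v 0 = v 1

end PromiseMC

/-! Truth of a positive formula passes along a surjection: equalities and existential witnesses are
pushed forward, and a universally quantified value is pulled back to a preimage
(`Formula.Holds.comp`). A surjection `A → B` gives the template property. A surjection `B → Bool`
reduces hardness to writing, in logarithmic space, a sentence that is true in `A` if `w ∈ L` and
false in `Bool` if `w ∉ L`.

A machine in polynomial space is simulated by a cellular automaton on `S = (|w| + 1 + C) ^ C` cells.
Before it halts it repeats no configuration, so `2 ^ S` steps are enough and acceptance can be read
off cell by cell (`TM.mem_iff_fine`). As in the hardness proof for quantified Boolean formulas, a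
game of `S` rounds tests whether one array leads to another in `2 ^ S` steps: the existential player
gives the array halfway, the universal player selects a half, and in the end a single step is
checked locally.

The difficulty is that a universal variable over `A` has `n = |A|` values instead of two, and no
negation is available to interpret them. Therefore `n` names of elements are guessed in advance, and
one game is played for each world `W : Fin n → Bool`, all in parallel. A challenge has to equal some
name `e`, and the game of `W` then continues with the half `W e`. In `A` the names can enumerate all
elements, and following the true run answers every challenge in every world (`rounds_intro`). In
`Bool` the values of the names themselves form a world. There the selected half is the challenge, so
both halves are tested and all arrays are forced (`rounds_elim`). As `A` is fixed, the number of
worlds is a constant.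

The bits `0` and `1` are two universally quantified constants, with equality of the two as an
alternative that makes the sentence true. Since each round requantifies the same variables, the
sentence is a concatenation of fixed templates, repeated with a running index below `S`. A
transducer that keeps a few binary counters writes it (`logspaceComputable_sentenceInstrs`). -/

namespace PromiseMC

/-! ### Fragments of one-tape transducers -/

instance finite_inSym {α : Type} [Finite α] : Finite (InSym α) :=
  Finite.of_surjective
    (fun o : Option (Option α) => match o with
      | none => InSym.leftEnd
      | some none => InSym.rightEnd
      | some (some a) => InSym.letter a)
    (by
      rintro (_ | a | _)
      exacts [⟨none, rfl⟩, ⟨some (some a), rfl⟩, ⟨some none, rfl⟩])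

/-- All positions beyond the word read as the right end marker, so confining the head to the input
tape does not affect what it reads. -/
theorem readInput_min {α : Type} (w : List α) (i : ℕ) :
    Transducer.readInput w (min i (w.length + 1)) = Transducer.readInput w i := by
  rcases le_total i (w.length + 1) with h | h
  · rw [min_eq_left h]
  · rw [min_eq_right h]
    obtain ⟨j, rfl⟩ : ∃ j, i = j + 1 := ⟨i - 1, by omega⟩
    simp only [Transducer.readInput]
    rw [List.getElem?_eq_none (by omega), List.getElem?_eq_none (by omega)]

/-- Work tape symbols: `none` is the blank, `some none` marks the left end of the tape, and
`some (some c)` is a column holding one bit of each of the counters `κ`. -/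
abbrev TapeSym (κ : Type) := Option (Option (κ → Bool))

/-- The part of a configuration that is not the state. -/
structure Mem (β κ : Type) where
  inHead : ℕ
  head : ℕ
  tape : ℕ → TapeSym κ
  out : List β

/-- A piece of a transducer with one work tape, which is left through one of the exits `E`. -/
structure Frag (α β κ E : Type) where
  Q : Type
  finQ : Finite Q
  start : Q
  δ : Q → InSym α → TapeSym κ → (Q ⊕ E) × Move × TapeSym κ × Move × Option β

namespace Frag

variable {α β κ E E' : Type}

def step (F : Frag α β κ E) (w : List α) (q : F.Q) (m : Mem β κ) : (F.Q ⊕ E) × Mem β κ :=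
  let r := F.δ q (Transducer.readInput w m.inHead) (m.tape m.head)
  (r.1,
    { inHead := min (r.2.1.apply m.inHead) (w.length + 1)
      head := r.2.2.2.1.apply m.head
      tape := Function.update m.tape m.head r.2.2.1
      out := m.out ++ r.2.2.2.2.toList })

/-- A run to an exit that scans only the work tape cells `0, …, h`. -/
inductive Run (F : Frag α β κ E) (w : List α) (h : ℕ) : F.Q → Mem β κ → E → Mem β κ → Prop
  | exit {q m e m'} (hm : m.head ≤ h) (hs : F.step w q m = (Sum.inr e, m')) : Run F w h q m e m'
  | next {q m q' m' e m''} (hm : m.head ≤ h) (hs : F.step w q m = (Sum.inl q', m'))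
      (hr : Run F w h q' m' e m'') : Run F w h q m e m''

/-- Run `F`, then continue with the fragment that belongs to the exit taken. -/
def bind [Finite E] (F : Frag α β κ E) (G : E → Frag α β κ E') : Frag α β κ E' where
  Q := F.Q ⊕ Σ e, (G e).Q
  finQ := by
    have := F.finQ
    have := fun e => (G e).finQ
    infer_instance
  start := Sum.inl F.start
  δ := fun q a s => match q with
    | .inl q =>
      let r := F.δ q a s
      (Sum.inl (r.1.elim Sum.inl fun e => Sum.inr ⟨e, (G e).start⟩), r.2)
    | .inr ⟨e, q⟩ =>
      let r := (G e).δ q a s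
      (r.1.map (fun q => Sum.inr ⟨e, q⟩) id, r.2)

/-- Repeat `F` as long as it is left through the exit `none`. -/
def iter (F : Frag α β κ (Option E)) : Frag α β κ E where
  Q := F.Q
  finQ := F.finQ
  start := F.start
  δ := fun q a s =>
    let r := F.δ q a s
    (r.1.elim Sum.inl fun e => e.elim (Sum.inl F.start) Sum.inr, r.2)

theorem Run.bind_right [Finite E] {F : Frag α β κ E} {G : E → Frag α β κ E'} {w : List α} {h : ℕ}
    {e : E} {q m e' m'} (hr : Run (G e) w h q m e' m') :
    Run (bind F G) w h (Sum.inr ⟨e, q⟩) m e' m' := by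
  induction hr with
  | exit hm hs =>
    refine .exit hm ?_
    simp only [step, Prod.mk.injEq] at hs ⊢
    simp only [Frag.bind, hs.1, Sum.map_inr, id, true_and]
    exact hs.2
  | next hm hs _ ih =>
    refine .next hm ?_ ih
    simp only [step, Prod.mk.injEq] at hs ⊢
    simp only [Frag.bind, hs.1, Sum.map_inl, true_and]
    exact hs.2

/-- The last step of `F` itself enters the start state of `G e`, so no additional step is needed
between the two runs. -/
theorem Run.bind [Finite E] {F : Frag α β κ E} {G : E → Frag α β κ E'} {w : List α} {h : ℕ}
    {q m e m' e' m''} (hr : Run F w h q m e m') (hr' : Run (G e) w h (G e).start m' e' m'') :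
    Run (bind F G) w h (Sum.inl q) m e' m'' := by
  induction hr with
  | exit hm hs =>
    refine .next hm ?_ hr'.bind_right
    simp only [step, Prod.mk.injEq] at hs ⊢
    simp only [Frag.bind, hs.1, Sum.elim_inr, true_and]
    exact hs.2
  | next hm hs _ ih =>
    refine .next hm ?_ (ih hr')
    simp only [step, Prod.mk.injEq] at hs ⊢
    simp only [Frag.bind, hs.1, Sum.elim_inl, true_and]
    exact hs.2

theorem Run.iter_some {F : Frag α β κ (Option E)} {w : List α} {h : ℕ} {q m e m'}
    {o : Option E} (hr : Run F w h q m o m') (ho : o = some e) :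
    Run (iter F) w h q m e m' := by
  induction hr with
  | exit hm hs =>
    subst ho
    refine .exit hm ?_
    simp only [step, Prod.mk.injEq] at hs ⊢
    simp only [Frag.iter, hs.1, Sum.elim_inr, Option.elim, true_and]
    exact hs.2
  | next hm hs _ ih =>
    refine .next (q' := _) hm ?_ (ih ho)
    simp only [step, Prod.mk.injEq] at hs ⊢
    simp only [Frag.iter, hs.1, Sum.elim_inl, true_and]
    exact hs.2

theorem Run.iter_none {F : Frag α β κ (Option E)} {w : List α} {h : ℕ} {q m e m' m''}
    {o : Option E} (hr : Run F w h q m o m') (ho : o = none)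
    (hr' : Run (iter F) w h F.start m' e m'') : Run (iter F) w h q m e m'' := by
  induction hr with
  | exit hm hs =>
    subst ho
    refine Run.next (F := Frag.iter F) (q' := F.start) hm ?_ hr'
    simp only [step, Prod.mk.injEq] at hs ⊢
    simp only [Frag.iter, hs.1, Sum.elim_inr, Option.elim, true_and]
    exact hs.2
  | next hm hs _ ih =>
    refine .next (q' := _) hm ?_ (ih ho hr')
    simp only [step, Prod.mk.injEq] at hs ⊢
    simp only [Frag.iter, hs.1, Sum.elim_inl, true_and]
    exact hs.2

/-- One step that leaves the work tape unchanged. -/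
def single (e : InSym α → E) (d : Move) (b : Option β) : Frag α β κ E where
  Q := Unit
  finQ := inferInstance
  start := ()
  δ := fun _ a s => (Sum.inr (e a), d, s, Move.stay, b)

/-- Write the left end mark. -/
def putMark : Frag α β κ Unit where
  Q := Unit
  finQ := inferInstance
  start := ()
  δ := fun _ _ _ => (Sum.inr (), Move.stay, some none, Move.stay, none)

/-- Run a sequential machine over the columns from left to right, possibly append a column, and
go back to the left end. -/
def sweep {σ : Type} [Finite σ] (s₀ : σ) (f : σ → (κ → Bool) → σ × (κ → Bool))
    (ext : σ → Option (κ → Bool)) (res : σ → E) : Frag α β κ E where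
  Q := Unit ⊕ σ ⊕ σ
  finQ := inferInstance
  start := Sum.inl ()
  δ := fun q _ a => match q with
    | .inl _ => (Sum.inl (.inr (.inl s₀)), .stay, a, .right, none)
    | .inr (.inl s) => match a with
      | some (some c) => (Sum.inl (.inr (.inl (f s c).1)), .stay, some (some (f s c).2), .right, none)
      | _ => (Sum.inl (.inr (.inr s)), .stay, (ext s).map some, .left, none)
    | .inr (.inr s) => match a with
      | some (some c) => (Sum.inl (.inr (.inr s)), .stay, some (some c), .left, none)
      | _ => (Sum.inr (res s), .stay, a, .stay, none)

/-- The tape with the left end mark on cell `0` followed by the columns `l`. -/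
def tapeOf (l : List (κ → Bool)) : ℕ → TapeSym κ
  | 0 => some none
  | i + 1 => l[i]?.map some

theorem tapeOf_append (l : List (κ → Bool)) (c : κ → Bool) (l' : List (κ → Bool)) :
    tapeOf (l ++ c :: l') (l.length + 1) = some (some c) := by
  simp [tapeOf]

theorem tapeOf_length (l : List (κ → Bool)) : tapeOf l (l.length + 1) = none := by
  simp [tapeOf]

theorem update_tapeOf_append (l : List (κ → Bool)) (c c' : κ → Bool) (l' : List (κ → Bool)) :
    Function.update (tapeOf (l ++ c :: l')) (l.length + 1) (some (some c')) =
      tapeOf (l ++ c' :: l') := by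
  funext i
  rcases i with _ | i
  · rfl
  · by_cases h : i = l.length
    · subst h; simp [tapeOf]
    · rw [Function.update_of_ne (by omega)]
      simp only [tapeOf]
      rcases lt_or_gt_of_ne h with h | h
      · rw [List.getElem?_append_left h, List.getElem?_append_left h]
      · rw [List.getElem?_append_right h.le, List.getElem?_append_right h.le]
        obtain ⟨k, hk⟩ : ∃ k, i - l.length = k + 1 := ⟨i - l.length - 1, by omega⟩
        rw [hk]; simp

theorem update_tapeOf_length (l : List (κ → Bool)) (o : Option (κ → Bool)) :
    Function.update (tapeOf l) (l.length + 1) (o.map some) = tapeOf (l ++ o.toList) := by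
  funext i
  rcases i with _ | i
  · rfl
  · by_cases h : i = l.length
    · subst h; cases o <;> simp [tapeOf]
    · rw [Function.update_of_ne (by omega)]
      simp only [tapeOf]
      rcases lt_or_gt_of_ne h with h | h
      · rw [List.getElem?_append_left h]
      · rw [List.getElem?_append_right h.le, List.getElem?_eq_none (by omega),
          List.getElem?_eq_none]
        cases o
        · simp
        · simp; omega

/-- The sequential machine of `sweep` on a list of columns. -/
def mealy {σ X : Type} (f : σ → X → σ × X) : σ → List X → σ × List X
  | s, [] => (s, [])
  | s, c :: l => ((mealy f (f s c).1 l).1, (f s c).2 :: (mealy f (f s c).1 l).2)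

theorem length_mealy {σ X : Type} (f : σ → X → σ × X) (s : σ) (l : List X) :
    (mealy f s l).2.length = l.length := by
  induction l generalizing s with
  | nil => rfl
  | cons c l ih => simp [mealy, ih]

/-- The columns after `sweep`. -/
def swept {σ X : Type} (f : σ → X → σ × X) (ext : σ → Option X) (s : σ) (l : List X) : List X :=
  (mealy f s l).2 ++ (ext (mealy f s l).1).toList

/-! ### Correctness of a sweep over the columns. -/

section Sweep

variable {σ : Type} [Finite σ] (s₀ : σ) (f : σ → (κ → Bool) → σ × (κ → Bool))
  (ext : σ → Option (κ → Bool)) (res : σ → E) (w : List α) (h i : ℕ) (out : List β)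

theorem run_sweep_back (hi : i ≤ w.length + 1) (l : List (κ → Bool)) (s : σ) (p : ℕ)
    (hp : p ≤ l.length) (hh : p ≤ h) :
    Run (sweep s₀ f ext res) w h (.inr (.inr s)) ⟨i, p, tapeOf l, out⟩ (res s) ⟨i, 0, tapeOf l, out⟩ := by
  induction p with
  | zero =>
    refine .exit hh ?_
    simp [step, sweep, tapeOf, Move.apply, hi]
  | succ p ih =>
    refine Run.next (F := sweep s₀ f ext res) (q' := Sum.inr (.inr s)) hh ?_ (ih (by omega) (by omega))
    have : tapeOf l (p + 1) = some (some l[p]) := by simp [tapeOf, show p < l.length by omega]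
    simp only [step, sweep, this, Move.apply, min_eq_left hi]
    rw [← this, Function.update_eq_self]
    simp

/-- Induction on the unread columns `l`, with the processed ones as prefix `pre`. The `+ 1` in the
space bound accounts for the first blank behind the columns, which has to be scanned. -/
theorem run_sweep_right (hi : i ≤ w.length + 1) (l pre : List (κ → Bool)) (s : σ)
    (hh : pre.length + l.length + 1 ≤ h) :
    Run (sweep s₀ f ext res) w h (.inr (.inl s)) ⟨i, pre.length + 1, tapeOf (pre ++ l), out⟩
      (res (mealy f s l).1) ⟨i, 0, tapeOf (pre ++ swept f ext s l), out⟩ := by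
  induction l generalizing pre s with
  | nil =>
    refine Run.next (F := sweep s₀ f ext res) (q' := Sum.inr (.inr s))
      (m' := ⟨i, pre.length, tapeOf (pre ++ (ext s).toList), out⟩)
      (by simp at hh ⊢; omega) ?_ ?_
    · rw [← update_tapeOf_length]
      simp [step, sweep, tapeOf_length, Move.apply, hi]
    · exact run_sweep_back s₀ f ext res w h i out hi _ s _ (by simp) (by simp at hh; omega)
  | cons c l ih =>
    have := ih (pre ++ [(f s c).2]) (f s c).1 (by simp at hh ⊢; omega)
    simp only [List.append_assoc, List.singleton_append, List.length_append, List.length_singleton]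
      at this
    refine Run.next (F := sweep s₀ f ext res) (q' := Sum.inr (.inl (f s c).1)) (by simp at hh ⊢; omega) ?_ this
    simp only [step, sweep, tapeOf_append, Move.apply, min_eq_left hi, update_tapeOf_append]
    simp

theorem run_sweep (hi : i ≤ w.length + 1) (l : List (κ → Bool)) (hh : l.length + 1 ≤ h) :
    Run (sweep s₀ f ext res) w h (sweep (α := α) (β := β) s₀ f ext res).start ⟨i, 0, tapeOf l, out⟩
      (res (mealy f s₀ l).1) ⟨i, 0, tapeOf (swept f ext s₀ l), out⟩ := by
  refine Run.next (F := sweep s₀ f ext res) (q' := Sum.inr (.inl s₀)) (Nat.zero_le _) ?_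
    (run_sweep_right s₀ f ext res w h i out hi l [] s₀ (by simpa using hh))
  simp [step, sweep, Move.apply, hi]

end Sweep

/-! ### Counters -/

/-- The number with the given binary digits, the least significant one first. -/
def ofDigits : List Bool → ℕ
  | [] => 0
  | b :: l => b.toNat + 2 * ofDigits l

/-- The memory `m` holds the counter values `v` in at most `H` columns. -/
def Rep (w : List α) (H : ℕ) (v : κ → ℕ) (i : ℕ) (m : Mem β κ) : Prop :=
  m.inHead = i ∧ i ≤ w.length + 1 ∧ m.head = 0 ∧ ∃ l : List (κ → Bool), l.length ≤ H ∧
    m.tape = tapeOf l ∧ ∀ c, ofDigits (l.map (· c)) = v c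

/-- Started with counters `v` and input head position `i`, the fragment is left through the exit `e`
with counters `v'`, input head position `i'` and additional output `o`. -/
def Does (F : Frag α β κ E) (w : List α) (H : ℕ) (v : κ → ℕ) (i : ℕ) (e : E) (v' : κ → ℕ) (i' : ℕ)
    (o : List β) : Prop :=
  ∀ m : Mem β κ, Rep w H v i m → ∃ m' : Mem β κ, Run F w (H + 1) F.start m e m' ∧
    Rep w H v' i' m' ∧ m'.out = m.out ++ o

variable {w : List α} {H : ℕ}

theorem Does.bind [Finite E] {F : Frag α β κ E} {G : E → Frag α β κ E'} {v i e v' i' o e' v'' i'' o'}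
    (h : Does F w H v i e v' i' o) (h' : Does (G e) w H v' i' e' v'' i'' o') :
    Does (bind F G) w H v i e' v'' i'' (o ++ o') := by
  intro m hm
  obtain ⟨m', hr, hm', ho⟩ := h m hm
  obtain ⟨m'', hr', hm'', ho'⟩ := h' m' hm'
  exact ⟨m'', hr.bind hr', hm'', by rw [ho', ho, List.append_assoc]⟩

theorem Does.iter_some {F : Frag α β κ (Option E)} {v i e v' i' o}
    (h : Does F w H v i (some e) v' i' o) : Does (iter F) w H v i e v' i' o := by
  intro m hm
  obtain ⟨m', hr, hm', ho⟩ := h m hm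
  exact ⟨m', hr.iter_some rfl, hm', ho⟩

theorem Does.iter_none {F : Frag α β κ (Option E)} {v i v' i' o e v'' i'' o'}
    (h : Does F w H v i none v' i' o) (h' : Does (iter F) w H v' i' e v'' i'' o') :
    Does (iter F) w H v i e v'' i'' (o ++ o') := by
  intro m hm
  obtain ⟨m', hr, hm', ho⟩ := h m hm
  obtain ⟨m'', hr', hm'', ho'⟩ := h' m' hm'
  exact ⟨m'', hr.iter_none rfl hr', hm'', by rw [ho', ho, List.append_assoc]⟩

theorem does_single (e : InSym α → E) (d : Move) (b : Option β) (v : κ → ℕ) (i : ℕ) :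
    Does (single e d b) w H v i (e (Transducer.readInput w i)) v
      (min (d.apply i) (w.length + 1)) b.toList := by
  rintro ⟨i', p, t, out⟩ ⟨rfl, hi, rfl, l, hl, rfl, hv⟩
  refine ⟨⟨min (d.apply i') (w.length + 1), 0, tapeOf l, out ++ b.toList⟩, .exit (Nat.zero_le _) ?_,
    ⟨rfl, min_le_right _ _, rfl, l, hl, rfl, hv⟩, rfl⟩
  simp [step, single, Move.apply]

/-- Digitwise comparison decides equality of values because all counters share the same columns and
thus have equally many digits; see `ofDigits_inj`. -/
def test (c c' : κ) : Frag α β κ Bool :=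
  sweep true (fun s x => (s && (x c == x c'), x)) (fun _ => none) id

theorem ofDigits_inj : ∀ l l' : List Bool, l.length = l'.length → ofDigits l = ofDigits l' → l = l'
  | [], [], _, _ => rfl
  | b :: l, b' :: l', h, h' => by
    simp only [ofDigits] at h'
    have : b.toNat = b'.toNat ∧ ofDigits l = ofDigits l' := by
      have := b.toNat_le; have := b'.toNat_le; omega
    rw [ofDigits_inj l l' (by simpa using h) this.2, show b = b' by cases b <;> cases b' <;> simp_all]
  | [], _ :: _, h, _ => by simp at h
  | _ :: _, [], h, _ => by simp at h

theorem mealy_test (c c' : κ) (s : Bool) (l : List (κ → Bool)) :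
    mealy (fun (s : Bool) (x : κ → Bool) => (s && (x c == x c'), x)) s l =
      (s && decide (l.map (· c) = l.map (· c')), l) := by
  induction l generalizing s with
  | nil => simp [mealy]
  | cons x l ih =>
    simp only [mealy, ih, List.map_cons, List.cons.injEq, Bool.decide_and, Bool.and_assoc]
    rw [beq_eq_decide]

theorem does_test (c c' : κ) (v : κ → ℕ) (i : ℕ) :
    Does (test (α := α) (β := β) c c') w H v i (decide (v c = v c')) v i [] := by
  rintro ⟨i', p, t, out⟩ ⟨rfl, hi, rfl, l, hl, rfl, hv⟩
  have h := run_sweep (α := α) (β := β) true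
    (fun (s : Bool) (x : κ → Bool) => (s && (x c == x c'), x)) (fun _ => none) id w (H + 1) i' out hi l
    (by omega)
  simp only [swept, mealy_test, Bool.true_and, Option.toList_none, List.append_nil] at h
  have hd : decide (l.map (· c) = l.map (· c')) = decide (v c = v c') := by
    rw [← hv, ← hv, decide_eq_decide]
    exact ⟨fun h => by rw [h], ofDigits_inj _ _ (by simp)⟩
  rw [hd] at h
  exact ⟨_, h, ⟨rfl, hi, rfl, l, hl, rfl, hv⟩, by simp⟩

variable [DecidableEq κ]

/-- The state of the sweep is the carry. A carry that survives becomes a new column, in which the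
other counters get the leading digit `0`. -/
def inc (c : κ) : Frag α β κ Unit :=
  sweep true (fun s x => (s && x c, Function.update x c (s ^^ x c)))
    (fun s => if s then some (Function.update (fun _ => false) c true) else none) fun _ => ()

def zero (c : κ) : Frag α β κ Unit :=
  sweep () (fun _ x => ((), Function.update x c false)) (fun _ => none) id

theorem ofDigits_append (l l' : List Bool) :
    ofDigits (l ++ l') = ofDigits l + 2 ^ l.length * ofDigits l' := by
  induction l with
  | nil => simp [ofDigits]
  | cons b l ih => simp only [List.cons_append, ofDigits, ih, List.length_cons, pow_succ]; ring

/-- The invariant of binary addition: an outgoing carry is worth `2 ^ l.length`. -/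
theorem mealy_inc (c : κ) (s : Bool) (l : List (κ → Bool)) :
    let r := mealy (fun (s : Bool) (x : κ → Bool) =>
      (s && x c, Function.update x c (s ^^ x c))) s l
    ofDigits (r.2.map (· c)) + r.1.toNat * 2 ^ l.length = ofDigits (l.map (· c)) + s.toNat ∧
      ∀ d, d ≠ c → ofDigits (r.2.map (· d)) = ofDigits (l.map (· d)) := by
  induction l generalizing s with
  | nil => simp [mealy, ofDigits]
  | cons x l ih =>
    obtain ⟨h1, h2⟩ := ih (s && x c)
    simp only [mealy, List.map_cons, ofDigits, List.length_cons, pow_succ]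
    refine ⟨?_, fun d hd => ?_⟩
    · simp only [Function.update_self]
      have : (s && x c).toNat * 2 + (s ^^ x c).toNat = (x c).toNat + s.toNat := by
        cases s <;> cases x c <;> rfl
      linarith
    · rw [h2 d hd, Function.update_of_ne hd]

theorem does_inc (c : κ) (v : κ → ℕ) (i : ℕ) (hc : v c + 1 < 2 ^ H) :
    Does (inc (α := α) (β := β) c) w H v i () (Function.update v c (v c + 1)) i [] := by
  rintro ⟨i', p, t, out⟩ ⟨rfl, hi, rfl, l, hl, rfl, hv⟩
  obtain ⟨h1, h2⟩ := mealy_inc c true l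
  refine ⟨_, run_sweep _ _ _ _ w (H + 1) i' out hi l (by omega), ⟨rfl, hi, rfl, _, ?_, rfl, ?_⟩,
    by simp⟩
  · simp only [swept, List.length_append, length_mealy]
    split_ifs with hs
    -- A surviving carry means `2 ^ l.length ≤ v c + 1 < 2 ^ H`, so there is room for one more
    -- column.
    · rw [hs, hv] at h1
      have : 2 ^ l.length < 2 ^ H := by
        simp only [Bool.toNat_true] at h1; omega
      have := (Nat.pow_lt_pow_iff_right (by norm_num : 1 < 2)).1 this
      simpa using this
    · simpa using hl
  · intro d
    simp only [swept, List.map_append, ofDigits_append, List.length_map, length_mealy]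
    by_cases hd : d = c
    · subst hd
      rw [Function.update_self, ← hv, ← Bool.toNat_true, ← h1]
      split_ifs with hs
      · simp [hs, ofDigits]
      · simp [Bool.eq_false_iff.2 hs, ofDigits]
    · rw [Function.update_of_ne hd, h2 d hd, hv]
      split_ifs
      · simp [ofDigits, Function.update_of_ne hd]
      · simp [ofDigits]

theorem does_zero (c : κ) (v : κ → ℕ) (i : ℕ) :
    Does (zero (α := α) (β := β) c) w H v i () (Function.update v c 0) i [] := by
  rintro ⟨i', p, t, out⟩ ⟨rfl, hi, rfl, l, hl, rfl, hv⟩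
  refine ⟨_, run_sweep _ _ _ _ w (H + 1) i' out hi l (by omega), ⟨rfl, hi, rfl, _, ?_, rfl, ?_⟩, by simp⟩
  · simpa [swept, length_mealy] using hl
  · have key : ∀ d, ofDigits ((mealy (fun (_ : Unit) (x : κ → Bool) =>
        ((), Function.update x c false)) () l).2.map (· d)) =
        if d = c then 0 else ofDigits (l.map (· d)) := by
      intro d
      clear hv hl hi
      induction l with
      | nil => simp [mealy, ofDigits]
      | cons x l ih =>
        simp only [mealy, List.map_cons, ofDigits, ih]
        by_cases hd : d = c
        · subst hd; simp
        · simp [hd]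
    intro d
    simp only [swept, Option.toList_none, List.append_nil, key, hv]
    by_cases hd : d = c
    · subst hd; simp
    · simp [hd]

end Frag
end PromiseMC

namespace PromiseMC
namespace Frag

variable {α β κ E E' : Type} {w : List α} {H : ℕ}

/-! ### Structured programs -/

/-- One fragment after another. -/
def seq (F : Frag α β κ Unit) (G : Frag α β κ E) : Frag α β κ E := bind F fun _ => G

theorem Does.seq {F : Frag α β κ Unit} {G : Frag α β κ E} {v i v' i' o e v'' i'' o'}
    (h : Does F w H v i () v' i' o) (h' : Does G w H v' i' e v'' i'' o') :
    Does (seq F G) w H v i e v'' i'' (o ++ o') := Does.bind h h'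

/-- The bound on the input head is part of `Rep`, so it is available for free. -/
theorem Does.of_le {F : Frag α β κ E} {v i e v' i' o}
    (h : i ≤ w.length + 1 → Does F w H v i e v' i' o) : Does F w H v i e v' i' o :=
  fun m hm => h hm.2.1 m hm

/-- Leave at once through the exit `e`. -/
def pure (e : E) : Frag α β κ E := single (fun _ => e) .stay none

theorem does_pure (e : E) (v : κ → ℕ) (i : ℕ) : Does (pure (β := β) e) w H v i e v i [] :=
  Does.of_le fun hi => by
    have := does_single (w := w) (H := H) (fun _ => e) .stay (none : Option β) v i
    rwa [show min (Move.stay.apply i) (w.length + 1) = i from min_eq_left hi] at this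

/-- Output a word. -/
def emit : List β → Frag α β κ Unit
  | [] => pure ()
  | b :: l => seq (single (fun _ => ()) .stay (some b)) (emit l)

theorem does_emit (l : List β) (v : κ → ℕ) (i : ℕ) : Does (emit l) w H v i () v i l :=
  Does.of_le fun hi => by
    induction l with
    | nil => exact does_pure () v i
    | cons b l ih =>
      have := does_single (w := w) (H := H) (fun _ => ()) .stay (some b) v i
      rw [show min (Move.stay.apply i) (w.length + 1) = i from min_eq_left hi] at this
      exact this.seq ih

/-- Move the input head, then branch on the symbol read. -/
def moveRead [Finite α] (d : Move) (G : InSym α → Frag α β κ E) : Frag α β κ E :=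
  seq (single (fun _ => ()) d none) (bind (single id .stay none) G)

theorem Does.moveRead [Finite α] {d : Move} {G : InSym α → Frag α β κ E} {v i e v' i' o}
    (h : Does (G (Transducer.readInput w (d.apply i))) w H v (min (d.apply i) (w.length + 1))
      e v' i' o) :
    Does (moveRead d G) w H v i e v' i' o := by
  refine (does_single (fun _ => ()) d (none : Option β) v i).seq
    (o' := o) (Does.bind (o := []) (o' := o) (does_single id .stay (none : Option β) v _) ?_)
  rw [readInput_min]
  simpa [Move.apply] using h

/-- `F` repeated `n` times. -/
def repeatN (F : Frag α β κ Unit) : ℕ → Frag α β κ Unit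
  | 0 => pure ()
  | n + 1 => seq F (repeatN F n)

theorem does_repeatN {F : Frag α β κ Unit} (V : ℕ → κ → ℕ) (i : ℕ) (n k : ℕ)
    (h : ∀ t, k ≤ t → t < k + n → Does F w H (V t) i () (V (t + 1)) i []) :
    Does (repeatN F n) w H (V k) i () (V (k + n)) i [] := by
  induction n generalizing k with
  | zero => exact does_pure () _ i
  | succ n ih =>
    have := ih (k + 1) fun t ht ht' => h t (by omega) (by omega)
    rw [show k + 1 + n = k + (n + 1) by ring] at this
    exact (h k le_rfl (by omega)).seq this

variable [DecidableEq κ]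

/-- `for c = 0, 1, …, c' - 1` do `F`; the counter `c` is `0` before and after. -/
def forLoop (c c' : κ) (F : Frag α β κ Unit) : Frag α β κ Unit :=
  seq (iter (bind (test c c') fun b =>
    if b then pure (some ()) else seq F (seq (inc c) (pure none)))) (zero c)

/-- `V t` is the memory after `t` passes with the loop counter reset to `0`; during pass `t` that
counter holds `t`. The limit `c'` has to keep its value, as it is compared anew before each pass. -/
theorem does_forLoop {c c' : κ} (hc : c ≠ c') {F : Frag α β κ Unit} (V : ℕ → κ → ℕ) (I : ℕ → ℕ)
    (o : ℕ → List β) (n : ℕ) (hV : ∀ t, V t c = 0) (hV' : ∀ t, V t c' = n) (hn : n < 2 ^ H)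
    (h : ∀ t, t < n → Does F w H (Function.update (V t) c t) (I t) ()
      (Function.update (V (t + 1)) c t) (I (t + 1)) (o t)) :
    Does (forLoop c c' F) w H (V 0) (I 0) () (V n) (I n) ((List.range n).flatMap o) := by
  -- Induction on the number `d` of passes that remain, since the loop unfolds at its front.
  have key : ∀ d t, t + d = n →
      Does (iter (bind (test c c') fun b =>
        if b then pure (some ()) else seq F (seq (inc c) (pure none)))) w H
        (Function.update (V t) c t) (I t) () (Function.update (V n) c n) (I n)
        ((List.range' t d).flatMap o) := by
    intro d
    induction d with
    | zero =>
      rintro t rfl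
      refine Does.iter_some (Does.bind (o := []) (o' := []) (does_test c c' _ _) ?_)
      rw [if_pos (by simp [Function.update_of_ne hc.symm, hV'])]
      exact does_pure _ _ _
    | succ d ih =>
      intro t ht
      have h1 := ih (t + 1) (by omega)
      refine Does.iter_none (o := o t) ?_ h1
      refine Does.bind (o := []) (o' := o t) (does_test c c' _ _) ?_
      rw [if_neg (by simp [Function.update_of_ne hc.symm, hV']; omega)]
      have h2 := does_inc (α := α) (β := β) (w := w) (H := H) c (Function.update (V (t + 1)) c t)
        (I (t + 1)) (by rw [Function.update_self]; omega)
      rw [Function.update_self, Function.update_idem] at h2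
      have h3 := (h t (by omega)).seq (h2.seq (does_pure (none : Option Unit) _ _))
      simpa using h3
  have h0 := key n 0 (by omega)
  have hz := does_zero (α := α) (β := β) (w := w) (H := H) c (Function.update (V n) c n) (I n)
  rw [Function.update_idem, ← hV n, Function.update_eq_self] at hz
  rw [Function.update_eq_self_iff.2 (hV 0).symm] at h0
  have := h0.seq hz
  rwa [List.append_nil, ← List.range_eq_range'] at this

end Frag

/-! ### From fragments to transducers -/

section ToTransducer

variable {α β κ : Type} [Finite κ]

/-- The transducer that runs a fragment and halts. -/
def Frag.toTransducer (F : Frag α β κ Unit) : Transducer α β where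
  k := 1
  Q := Option F.Q
  Γ := TapeSym κ
  finQ := have := F.finQ; inferInstance
  finΓ := inferInstance
  blank := none
  start := some F.start
  δ := fun q a s => q.map fun q =>
    let r := F.δ q a (s 0)
    (r.1.elim some fun _ => none, r.2.1, fun _ => (r.2.2.1, r.2.2.2.1), r.2.2.2.2)

/-- The configuration of the transducer with the given state and memory. -/
def Mem.toCfg (F : Frag α β κ Unit) (q : Option F.Q) (m : Mem β κ) : F.toTransducer.Cfg where
  state := q
  inHead := m.inHead
  heads := fun _ => m.head
  tapes := fun _ => m.tape
  out := m.out

theorem Frag.step_toTransducer (F : Frag α β κ Unit) (w : List α) (q : F.Q) (m : Mem β κ) :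
    F.toTransducer.step w (m.toCfg F (some q)) =
      some ((F.step w q m).2.toCfg F ((F.step w q m).1.elim some fun _ => none)) := rfl

theorem Frag.step_toTransducer_none (F : Frag α β κ Unit) (w : List α) (m : Mem β κ) :
    F.toTransducer.step w (m.toCfg F none) = none := rfl

/-- By determinism every reachable configuration lies on the given run, so the space bound along the
run holds for all of them. -/
theorem Frag.Run.toTransducer {F : Frag α β κ Unit} {w : List α} {h : ℕ} {q m e m'}
    (hr : F.Run w h q m e m') (h' : m'.head ≤ h) :
    StateTransition.Reaches (F.toTransducer.step w) (m.toCfg F (some q)) (m'.toCfg F none) ∧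
      ∀ c, StateTransition.Reaches (F.toTransducer.step w) (m.toCfg F (some q)) c →
        ∀ i, c.heads i ≤ h := by
  have main : ∀ (q : F.Q) (m : Mem β κ) (c' : F.toTransducer.Cfg), m.head ≤ h →
      F.toTransducer.step w (m.toCfg F (some q)) = some c' →
      (StateTransition.Reaches (F.toTransducer.step w) c' (m'.toCfg F none) ∧
        ∀ c, StateTransition.Reaches (F.toTransducer.step w) c' c → ∀ i, c.heads i ≤ h) →
      StateTransition.Reaches (F.toTransducer.step w) (m.toCfg F (some q)) (m'.toCfg F none) ∧
      ∀ c, StateTransition.Reaches (F.toTransducer.step w) (m.toCfg F (some q)) c →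
        ∀ i, c.heads i ≤ h := by
    intro q m c' hm hs ⟨h1, h2⟩
    refine ⟨Relation.ReflTransGen.head hs h1, fun c hc => ?_⟩
    rcases Relation.ReflTransGen.cases_head hc with rfl | ⟨c'', hs', hc⟩
    · exact fun _ => hm
    · have : c'' = c' := Option.some.inj ((Option.mem_def.1 hs').symm.trans hs)
      subst this
      exact h2 c hc
  induction hr with
  | @exit q m e m' hm hs =>
    refine main q m _ hm (by rw [step_toTransducer, hs]; rfl)
      ⟨Relation.ReflTransGen.refl, fun c hc => ?_⟩
    rcases Relation.ReflTransGen.cases_head hc with rfl | ⟨c'', hs', _⟩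
    · exact fun _ => h'
    · change F.toTransducer.step w (m'.toCfg F none) = some c'' at hs'
      rw [step_toTransducer_none] at hs'
      cases hs'
  | next hm hs _ ih => exact main _ _ _ hm (by rw [step_toTransducer, hs]; rfl) (ih h' main)

/-- The `H + 2` cells are the end mark, up to `H` columns, and the blank behind them. -/
theorem logspaceComputable_of_does (F : Frag α β κ Unit) (f : List α → List β) (C : ℕ)
    (hF : ∀ w : List α, ∃ H v i, H + 2 ≤ C * (Nat.log 2 w.length + 1) ∧
      Frag.Does F w H 0 0 () v i (f w)) : LogspaceComputable f := by
  have key : ∀ w : List α, ∃ h m, h < C * (Nat.log 2 w.length + 1) ∧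
      (Frag.seq Frag.putMark F).Run w h (Frag.seq Frag.putMark F).start ⟨0, 0, fun _ => none, []⟩
        () m ∧ m.head ≤ h ∧ m.out = f w := by
    intro w
    obtain ⟨H, v, i, hH, hD⟩ := hF w
    obtain ⟨m, hr, hm, ho⟩ := hD ⟨0, 0, Frag.tapeOf [], []⟩
      ⟨rfl, Nat.zero_le _, rfl, [], Nat.zero_le _, rfl, fun _ => rfl⟩
    refine ⟨H + 1, m, hH, Frag.Run.bind (e := ()) (.exit (Nat.zero_le _) ?_) hr, ?_, by simpa using ho⟩
    · simp only [Frag.step, Frag.putMark, Move.apply, Nat.zero_le, min_eq_left]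
      congr 2
      funext j
      rcases j with _ | j <;> simp [Frag.tapeOf]
    · rw [hm.2.2.1]; exact Nat.zero_le _
  refine ⟨(Frag.seq Frag.putMark F).toTransducer, C, fun w => ?_, fun w c hc i => ?_⟩
  · obtain ⟨h, m, -, hr, hm, ho⟩ := key w
    exact ⟨_, (hr.toTransducer hm).1, Frag.step_toTransducer_none _ _ _, ho⟩
  · obtain ⟨h, m, hlt, hr, hm, -⟩ := key w
    exact ((hr.toTransducer hm).2 c hc i).trans_lt hlt

end ToTransducer
end PromiseMC

namespace PromiseMC
namespace Frag

variable {α β : Type} {w : List α} {H : ℕ}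

/-! ### A program that computes a power and writes words along loops of that length -/

/-- The values of the six counters: the base and the value of the power, an auxiliary value, and three
loop variables. -/
def store (N S T j s l : ℕ) : Fin 6 → ℕ := ![N, S, T, j, s, l]

theorem update_store_zero (N S T j s l x : ℕ) :
    Function.update (store N S T j s l) 0 x = store x S T j s l := by
  funext k; fin_cases k <;> rfl
theorem update_store_one (N S T j s l x : ℕ) :
    Function.update (store N S T j s l) 1 x = store N x T j s l := by
  funext k; fin_cases k <;> rfl
theorem update_store_two (N S T j s l x : ℕ) :
    Function.update (store N S T j s l) 2 x = store N S x j s l := by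
  funext k; fin_cases k <;> rfl
theorem update_store_three (N S T j s l x : ℕ) :
    Function.update (store N S T j s l) 3 x = store N S T x s l := by
  funext k; fin_cases k <;> rfl
theorem update_store_four (N S T j s l x : ℕ) :
    Function.update (store N S T j s l) 4 x = store N S T j x l := by
  funext k; fin_cases k <;> rfl
theorem update_store_five (N S T j s l x : ℕ) :
    Function.update (store N S T j s l) 5 x = store N S T j s x := by
  funext k; fin_cases k <;> rfl

theorem flatMap_nil_word {X : Type} (l : List X) : l.flatMap (fun _ => ([] : List β)) = [] := by
  simp [List.flatMap_eq_nil_iff]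

/-- Multiply the counter `1` by the counter `0`. -/
def mul : Frag α β (Fin 6) Unit :=
  seq (forLoop 3 1 (forLoop 4 0 (inc 2))) (seq (zero 1) (seq (forLoop 3 2 (inc 1)) (zero 2)))

/-- Multiplication by counting: `N` increments of the auxiliary counter in each of `S` passes, after
which the product is counted back into the counter `1`. All intermediate values are bounded by the
operands or the product. -/
theorem does_mul (N S i : ℕ) (hN : N < 2 ^ H) (hS : S < 2 ^ H) (h : S * N < 2 ^ H) :
    Does (mul (α := α) (β := β)) w H (store N S 0 0 0 0) i () (store N (S * N) 0 0 0 0) i [] := by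
  have h1 : ∀ t, t < S → Does (forLoop 4 0 (inc (α := α) (β := β) 2)) w H
      (store N S (t * N) t 0 0) i () (store N S ((t + 1) * N) t 0 0) i [] := by
    intro t ht
    have ht' : (t + 1) * N ≤ S * N := Nat.mul_le_mul_right _ ht
    have := does_forLoop (c := (4 : Fin 6)) (c' := 0) (by decide) (F := inc (α := α) (β := β) 2)
      (w := w) (H := H) (fun u => store N S (t * N + u) t 0 0) (fun _ => i) (fun _ => []) N
      (fun _ => rfl) (fun _ => rfl) hN fun u hu => by
        rw [update_store_four, update_store_four]
        have := does_inc (α := α) (β := β) (w := w) (H := H) 2 (store N S (t * N + u) t u 0) i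
          (by change t * N + u + 1 < _; rw [Nat.succ_mul] at ht'; omega)
        rwa [update_store_two] at this
    rw [Nat.succ_mul]
    simpa [flatMap_nil_word] using this
  have h2 := does_forLoop (c := (3 : Fin 6)) (c' := 1) (by decide)
      (F := forLoop 4 0 (inc (α := α) (β := β) 2))
      (w := w) (H := H) (fun t => store N S (t * N) 0 0 0) (fun _ => i) (fun _ => []) S
      (fun _ => rfl) (fun _ => rfl) hS fun t ht => by
        rw [update_store_three, update_store_three]
        exact h1 t ht
  have h3 := does_zero (α := α) (β := β) (w := w) (H := H) 1 (store N S (S * N) 0 0 0) i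
  rw [update_store_one] at h3
  have h4 := does_forLoop (c := (3 : Fin 6)) (c' := 2) (by decide) (F := inc (α := α) (β := β) 1)
      (w := w) (H := H) (fun u => store N u (S * N) 0 0 0) (fun _ => i) (fun _ => []) (S * N)
      (fun _ => rfl) (fun _ => rfl) h fun u hu => by
        rw [update_store_three, update_store_three]
        have := does_inc (α := α) (β := β) (w := w) (H := H) 1 (store N u (S * N) u 0 0) i
          (by change u + 1 < _; omega)
        rwa [update_store_one] at this
  have h5 := does_zero (α := α) (β := β) (w := w) (H := H) 2 (store N (S * N) (S * N) 0 0 0) i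
  rw [update_store_two] at h5
  have := h2.seq (h3.seq (h4.seq h5))
  simp only [zero_mul, flatMap_nil_word, List.append_nil] at this
  exact this

/-- Put the length of the input plus `1` on top of the counter `0`. -/
def count [Finite α] : Frag α β (Fin 6) Unit :=
  iter (moveRead .stay fun a => match a with
    | .rightEnd => pure (some ())
    | _ => seq (inc 0) (seq (single (fun _ => ()) .right none) (pure none)))

/-- Move the input head to the left end. -/
def rewind [Finite α] : Frag α β (Fin 6) Unit :=
  iter (moveRead .stay fun a => match a with
    | .leftEnd => pure (some ())
    | _ => seq (single (fun _ => ()) .left none) (pure none))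

theorem readInput_ne_rightEnd (w : List α) (i : ℕ) (hi : i ≤ w.length) :
    Transducer.readInput w i ≠ .rightEnd := by
  rcases i with _ | i
  · simp [Transducer.readInput]
  · simp [Transducer.readInput, show i < w.length by omega]

theorem readInput_succ_ne_leftEnd (w : List α) (i : ℕ) :
    Transducer.readInput w (i + 1) ≠ .leftEnd := by
  simp only [Transducer.readInput]
  cases w[i]? <;> simp

/-- Induction on the distance `d` to the right end marker. Started at the left end marker, which is
counted too, the fragment adds `|w| + 1`. -/
theorem does_count [Finite α] (d i N : ℕ) (hi : i + d = w.length + 1) (hN : N + d < 2 ^ H) :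
    Does (count (α := α) (β := β)) w H (store N 0 0 0 0 0) i () (store (N + d) 0 0 0 0 0)
      (w.length + 1) [] := by
  induction d generalizing i N with
  | zero =>
    obtain rfl : i = w.length + 1 := by omega
    refine Does.iter_some (Does.moveRead ?_)
    have : Transducer.readInput w (Move.stay.apply (w.length + 1)) = .rightEnd := by
      simp [Move.apply, Transducer.readInput]
    rw [this]
    simpa [Move.apply] using does_pure (w := w) (H := H) (β := β) (some ()) (store N 0 0 0 0 0)
      (w.length + 1)
  | succ d ih =>
    have h1 := ih (i + 1) (N + 1) (by omega) (by omega)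
    rw [show N + 1 + d = N + (d + 1) by ring] at h1
    refine Does.iter_none (o := []) (Does.moveRead ?_) h1
    have h2 := readInput_ne_rightEnd w i (by omega)
    have h3 := does_inc (α := α) (β := β) (w := w) (H := H) 0 (store N 0 0 0 0 0) i
      (by change N + 1 < _; omega)
    rw [update_store_zero] at h3
    have h4 := h3.seq ((does_single (w := w) (H := H) (fun _ => ()) .right (none : Option β)
      (store (N + 1) 0 0 0 0 0) i).seq (does_pure (none : Option Unit) _ _))
    rw [show min (Move.right.apply i) (w.length + 1) = i + 1 by simp [Move.apply]; omega] at h4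
    rw [show min (Move.stay.apply i) (w.length + 1) = i by simp [Move.apply]; omega]
    simp only [Move.apply]
    revert h2
    cases Transducer.readInput w i <;> intro h2
    · exact h4
    · exact h4
    · exact absurd rfl h2

theorem does_rewind [Finite α] (i : ℕ) (v : Fin 6 → ℕ) (hi : i ≤ w.length + 1) :
    Does (rewind (α := α) (β := β)) w H v i () v 0 [] := by
  induction i with
  | zero =>
    refine Does.iter_some (Does.moveRead ?_)
    exact does_pure (some ()) v 0
  | succ i ih =>
    refine Does.iter_none (o := []) (Does.moveRead ?_) (ih (by omega))
    have h2 := readInput_succ_ne_leftEnd w i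
    have h4 := (does_single (w := w) (H := H) (fun _ => ()) .left (none : Option β)
      v (i + 1)).seq (does_pure (none : Option Unit) _ _)
    rw [show min (Move.left.apply (i + 1)) (w.length + 1) = i by simp [Move.apply]; omega] at h4
    rw [show min (Move.stay.apply (i + 1)) (w.length + 1) = i + 1 by simp [Move.apply]; omega]
    simp only [Move.apply]
    revert h2
    cases Transducer.readInput w (i + 1) <;> intro h2
    · exact absurd rfl h2
    · exact h4
    · exact h4

/-- Compute `(|w| + 1 + C) ^ C` in the counter `1`. -/
def power [Finite α] (C : ℕ) : Frag α β (Fin 6) Unit :=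
  seq (repeatN (inc 0) C) (seq count (seq rewind (seq (inc 1) (repeatN mul C))))

theorem does_power [Finite α] (C : ℕ) (hC : 0 < C) (hH : (w.length + 1 + C) ^ C < 2 ^ H) :
    Does (power (α := α) (β := β) C) w H 0 0 ()
      (store (w.length + 1 + C) ((w.length + 1 + C) ^ C) 0 0 0 0) 0 [] := by
  -- As the exponent is positive, the base is at most the power and fits into the columns as well.
  have hN : w.length + 1 + C < 2 ^ H := (Nat.le_self_pow hC.ne' _).trans_lt hH
  have h1 := does_repeatN (w := w) (H := H) (F := inc (α := α) (β := β) 0)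
    (fun t => store t 0 0 0 0 0) 0 C 0 fun t _ ht => by
      have := does_inc (α := α) (β := β) (w := w) (H := H) 0 (store t 0 0 0 0 0) 0
        (by change t + 1 < _; omega)
      rwa [update_store_zero] at this
  rw [show store 0 0 0 0 0 0 = 0 by funext k; fin_cases k <;> rfl, zero_add] at h1
  have h2 := does_count (β := β) (w := w) (H := H) (w.length + 1) 0 C (by omega) (by omega)
  rw [show C + (w.length + 1) = w.length + 1 + C by ring] at h2
  have h3 := does_rewind (β := β) (w := w) (H := H) (w.length + 1)
    (store (w.length + 1 + C) 0 0 0 0 0) le_rfl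
  have h4 := does_inc (α := α) (β := β) (w := w) (H := H) 1 (store (w.length + 1 + C) 0 0 0 0 0) 0
    (by change 0 + 1 < _; omega)
  rw [update_store_one] at h4
  have h5 := does_repeatN (w := w) (H := H) (F := mul (α := α) (β := β))
    (fun t => store (w.length + 1 + C) ((w.length + 1 + C) ^ t) 0 0 0 0) 0 C 0 fun t _ ht => by
      have hle : ∀ t, t ≤ C → (w.length + 1 + C) ^ t < 2 ^ H := fun t ht =>
        (Nat.pow_le_pow_right (by omega) ht).trans_lt hH
      simp only [pow_succ]
      exact does_mul _ _ 0 hN (hle t (by omega)) (by rw [← pow_succ]; exact hle _ (by omega))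
  simp only [pow_zero, zero_add] at h5
  exact h1.seq (h2.seq (h3.seq (h4.seq h5)))

/-! ### Writing words from templates. -/

/-- The word of a template, where `none` stands for `j` times the word `u`. -/
def expand (u : List β) (j : ℕ) (T : List (Option β)) : List β :=
  T.flatMap fun o => o.elim ((List.range j).flatMap fun _ => u) fun b => [b]

/-- Write a template, for the value of the counter `3`. -/
def tmpl (u : List β) : List (Option β) → Frag α β (Fin 6) Unit
  | [] => pure ()
  | o :: T => seq (o.elim (forLoop 4 3 (emit u)) fun b => emit [b]) (tmpl u T)

theorem does_tmpl (u : List β) (T : List (Option β)) (N S j l i : ℕ) (hj : j < 2 ^ H) :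
    Does (tmpl u T) w H (store N S 0 j 0 l) i () (store N S 0 j 0 l) i (expand u j T) := by
  induction T with
  | nil => exact does_pure () _ i
  | cons o T ih =>
    refine Does.seq ?_ ih
    cases o with
    | some b => exact does_emit _ _ _
    | none =>
      exact does_forLoop (by decide) (fun _ => store N S 0 j 0 l) (fun _ => i) (fun _ => u) j
        (fun _ => rfl) (fun _ => rfl) hj fun t _ => does_emit _ _ _

/-- Write a template once or for all values below the counter `1` of the loop variable. -/
def writeSection (u : List β) (s : Bool × List (Option β)) : Frag α β (Fin 6) Unit :=
  if s.1 then forLoop 3 1 (tmpl u s.2) else tmpl u s.2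

/-- What `writeSection` writes. -/
def sectionOut (u : List β) (S : ℕ) (s : Bool × List (Option β)) : List β :=
  if s.1 then (List.range S).flatMap fun j => expand u j s.2 else expand u 0 s.2

theorem does_section (u : List β) (s : Bool × List (Option β)) (N S l i : ℕ) (hS : S < 2 ^ H) :
    Does (writeSection u s) w H (store N S 0 0 0 l) i () (store N S 0 0 0 l) i (sectionOut u S s) := by
  unfold writeSection sectionOut
  split_ifs
  · refine does_forLoop (by decide) (fun _ => store N S 0 0 0 l) (fun _ => i)
      (fun j => expand u j s.2) S (fun _ => rfl) (fun _ => rfl) hS fun t ht => ?_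
    rw [update_store_three]
    exact does_tmpl _ _ _ _ _ _ _ (by omega)
  · exact does_tmpl _ _ _ _ _ _ _ (by omega)

def sections (u : List β) : List (Bool × List (Option β)) → Frag α β (Fin 6) Unit
  | [] => pure ()
  | s :: L => seq (writeSection u s) (sections u L)

theorem does_sections (u : List β) (L : List (Bool × List (Option β))) (N S l i : ℕ)
    (hS : S < 2 ^ H) :
    Does (sections u L) w H (store N S 0 0 0 l) i () (store N S 0 0 0 l) i
      (L.flatMap (sectionOut u S)) := by
  induction L with
  | nil => exact does_pure () _ i
  | cons s L ih => exact (does_section _ _ _ _ _ _ hS).seq ih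

/-- Write a template that depends on the input symbol, moving along the input. -/
def inputLoop [Finite α] (u : List β) (T : InSym α → List (Option β)) : Frag α β (Fin 6) Unit :=
  forLoop 3 1 (moveRead .right fun a => tmpl u (T a))

/-- The loop runs on after the head has reached the right end marker and stays there. The symbols in
the output may nevertheless be indexed without the minimum, by `readInput_min`. -/
theorem does_inputLoop [Finite α] (u : List β) (T : InSym α → List (Option β)) (N S i : ℕ)
    (hS : S < 2 ^ H) :
    Does (inputLoop u T) w H (store N S 0 0 0 0) (min i (w.length + 1)) () (store N S 0 0 0 0)
      (min (i + S) (w.length + 1))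
      ((List.range S).flatMap fun j => expand u j (T (Transducer.readInput w (i + j + 1)))) := by
  refine does_forLoop (by decide) (fun _ => store N S 0 0 0 0) (fun t => min (i + t) (w.length + 1))
    (fun j => expand u j (T (Transducer.readInput w (i + j + 1)))) S
    (fun _ => rfl) (fun _ => rfl) hS fun t ht => ?_
  rw [update_store_three]
  refine Does.moveRead ?_
  have h1 : min (Move.right.apply (min (i + t) (w.length + 1))) (w.length + 1) =
      min (i + (t + 1)) (w.length + 1) := by simp only [Move.apply]; omega
  rw [← readInput_min, h1, readInput_min]
  exact does_tmpl _ _ _ _ _ _ _ (by omega)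

/-- The whole program: sections, the two input dependent parts, sections, a loop over sections, and
sections. -/
def program [Finite α] (C : ℕ) (u : List β) (L₁ : List (Bool × List (Option β)))
    (T T' : InSym α → List (Option β)) (L₂ L₃ L₄ : List (Bool × List (Option β))) :
    Frag α β (Fin 6) Unit :=
  seq (power C) (seq (sections u L₁) (seq (moveRead .right fun a => tmpl u (T a))
    (seq (inputLoop u T') (seq (sections u L₂) (seq (forLoop 5 1 (sections u L₃))
      (sections u L₄))))))

/-- What `program` writes, for the value `S` of the power. -/
def programOut (u : List β) (L₁ : List (Bool × List (Option β)))
    (T T' : InSym α → List (Option β)) (L₂ L₃ L₄ : List (Bool × List (Option β))) (S : ℕ)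
    (w : List α) : List β :=
  L₁.flatMap (sectionOut u S) ++ (expand u 0 (T (Transducer.readInput w 1)) ++
    (((List.range S).flatMap fun j => expand u j (T' (Transducer.readInput w (j + 2)))) ++
      (L₂.flatMap (sectionOut u S) ++
        (((List.range S).flatMap fun _ => L₃.flatMap (sectionOut u S)) ++
          L₄.flatMap (sectionOut u S)))))

theorem does_program [Finite α] (C : ℕ) (hC : 0 < C) (u : List β) (L₁ : List (Bool × List (Option β)))
    (T T' : InSym α → List (Option β)) (L₂ L₃ L₄ : List (Bool × List (Option β)))
    (hH : (w.length + 1 + C) ^ C < 2 ^ H) :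
    ∃ v i, Does (program C u L₁ T T' L₂ L₃ L₄) w H 0 0 () v i
      (programOut u L₁ T T' L₂ L₃ L₄ ((w.length + 1 + C) ^ C) w) := by
  set N := w.length + 1 + C
  set S := N ^ C
  have h1 := does_power (β := β) C hC hH
  have h2 := does_sections (w := w) u L₁ N S 0 0 hH
  -- The first letter has a template of its own: its cell will also carry the start state of the
  -- machine.
  have h3 : Does (moveRead .right fun a => tmpl u (T a)) w H (store N S 0 0 0 0) 0 ()
      (store N S 0 0 0 0) (min 1 (w.length + 1)) (expand u 0 (T (Transducer.readInput w 1))) :=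
    Does.moveRead (does_tmpl _ _ _ _ _ _ _ (by positivity))
  have h4 := does_inputLoop (w := w) u T' N S 1 hH
  have h5 := does_sections (w := w) u L₂ N S 0 (min (1 + S) (w.length + 1)) hH
  have h6 := does_forLoop (w := w) (c := 5) (c' := 1) (by decide) (F := sections u L₃)
    (fun _ => store N S 0 0 0 0)
    (fun _ => min (1 + S) (w.length + 1)) (fun _ => L₃.flatMap (sectionOut u S)) S (fun _ => rfl)
    (fun _ => rfl) hH fun t ht => by
      rw [update_store_five]
      exact does_sections (w := w) u L₃ N S t (min (1 + S) (w.length + 1)) hH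
  have h7 := does_sections (w := w) u L₄ N S 0 (min (1 + S) (w.length + 1)) hH
  have := h1.seq (h2.seq (h3.seq (h4.seq (h5.seq (h6.seq h7)))))
  simp only [List.nil_append, show ∀ j, 1 + j + 1 = j + 2 from fun j => by ring] at this
  exact ⟨_, _, this⟩

end Frag

/-- The counters are polynomially bounded in the length of the input, so their number of binary
digits is logarithmic. -/
theorem logspaceComputable_programOut {α β : Type} [Finite α] (C : ℕ) (hC : 0 < C) (u : List β)
    (L₁ : List (Bool × List (Option β))) (T T' : InSym α → List (Option β))
    (L₂ L₃ L₄ : List (Bool × List (Option β))) :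
    LogspaceComputable fun w =>
      Frag.programOut u L₁ T T' L₂ L₃ L₄ ((w.length + 1 + C) ^ C) w := by
  -- With `H = C * (C + k) + 1` the space is `H + 2 = C * C + C * k + 3`, and `k ≥ 1` bounds this by
  -- `(C * (C + 1) + 3) * k`.
  refine logspaceComputable_of_does (Frag.program C u L₁ T T' L₂ L₃ L₄) _ (C * (C + 1) + 3)
    fun w => ?_
  set k := Nat.log 2 w.length + 1 with hk
  have hH : (w.length + 1 + C) ^ C < 2 ^ (C * (C + k) + 1) := by
    have h1 : w.length + 1 ≤ 2 ^ k := Nat.lt_pow_succ_log_self (by norm_num) _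
    have h2 : C + 1 ≤ 2 ^ C := Nat.lt_two_pow_self
    have h3 : w.length + 1 + C ≤ 2 ^ (C + k) := by
      rw [pow_add]
      calc w.length + 1 + C ≤ (C + 1) * (w.length + 1) := by ring_nf; nlinarith
        _ ≤ _ := Nat.mul_le_mul h2 h1
    calc (w.length + 1 + C) ^ C ≤ (2 ^ (C + k)) ^ C := Nat.pow_le_pow_left h3 C
      _ = 2 ^ (C * (C + k)) := by rw [← pow_mul, mul_comm]
      _ < _ := Nat.pow_lt_pow_right (by norm_num) (by omega)
  obtain ⟨v, i, h⟩ := Frag.does_program C hC u L₁ T T' L₂ L₃ L₄ hH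
  refine ⟨_, v, i, ?_, h⟩
  have : 1 ≤ k := by omega
  nlinarith [Nat.mul_le_mul_left (C * C) this]

end PromiseMC

namespace PromiseMC

/-! ### Positive formulas and surjections -/

/-- Any map preserves equality. Surjectivity enters only at universal quantifiers, where a value in
`B` is replaced by a preimage. -/
theorem Formula.Holds.comp {A B : Type*} (f : A → B) (hf : Function.Surjective f)
    {φ : Formula eqLang} : ∀ {ε : ℕ → A}, φ.Holds ε → φ.Holds (f ∘ ε) := by
  induction φ with
  | rel R v =>
    intro ε h
    cases R
    exact congrArg f h
  | and φ ψ ih ih' => exact fun h => ⟨ih h.1, ih' h.2⟩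
  | or φ ψ ih ih' => exact fun h => h.imp ih ih'
  | ex x φ ih =>
    rintro ε ⟨a, h⟩
    refine ⟨f a, ?_⟩
    rw [← Function.comp_update]
    exact ih h
  | all x φ ih =>
    intro ε h b
    obtain ⟨a, rfl⟩ := hf b
    rw [← Function.comp_update]
    exact ih (h a)

theorem Formula.TrueIn.of_surjective {A B : Type*} (f : A → B) (hf : Function.Surjective f)
    {φ : Formula eqLang} (h : φ.TrueIn A) : φ.TrueIn B := by
  intro ε
  -- Every evaluation in `B` is the image of an evaluation in `A`, by a right inverse of `f`.
  have := (h (Function.surjInv hf ∘ ε)).comp f hf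
  rwa [← Function.comp_assoc, (Function.rightInverse_surjInv hf).comp_eq_id] at this

/-! ### Sentences given by lists of instructions -/

/-- Quantifier-free positive formulas in equality, with variables from `V`. -/
inductive PFormula (V : Type) : Type
  | eq (x y : V) : PFormula V
  | and (φ ψ : PFormula V) : PFormula V
  | or (φ ψ : PFormula V) : PFormula V

namespace PFormula

variable {V V' : Type}

def Holds {A : Type*} : PFormula V → (V → A) → Prop
  | eq x y, ρ => ρ x = ρ y
  | and φ ψ, ρ => φ.Holds ρ ∧ ψ.Holds ρ
  | or φ ψ, ρ => φ.Holds ρ ∨ ψ.Holds ρ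

def map (f : V → V') : PFormula V → PFormula V'
  | eq x y => eq (f x) (f y)
  | and φ ψ => and (φ.map f) (ψ.map f)
  | or φ ψ => or (φ.map f) (ψ.map f)

def vars : PFormula V → Set V
  | eq x y => {x, y}
  | and φ ψ => φ.vars ∪ ψ.vars
  | or φ ψ => φ.vars ∪ ψ.vars

def toFormula (num : V → ℕ) : PFormula V → Formula eqLang
  | eq x y => Formula.rel (n := 2) EqRel.eq ![num x, num y]
  | and φ ψ => Formula.and (φ.toFormula num) (ψ.toFormula num)
  | or φ ψ => Formula.or (φ.toFormula num) (ψ.toFormula num)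

/-- The word of the formula, where variables are written by means of `t` and letters by means
of `s`. -/
def word {β : Type} (s : Letter eqLang → β) (t : V → List β) : PFormula V → List β
  | eq x y => s (Letter.rel (n := 2) EqRel.eq) :: (t x ++ t y)
  | and φ ψ => s Letter.and :: (φ.word s t ++ ψ.word s t)
  | or φ ψ => s Letter.or :: (φ.word s t ++ ψ.word s t)

theorem holds_map {A : Type*} (f : V → V') (ρ : V' → A) (φ : PFormula V) :
    (φ.map f).Holds ρ ↔ φ.Holds (ρ ∘ f) := by
  induction φ with
  | eq x y => rfl
  | and φ ψ ih ih' => simp only [map, Holds, ih, ih']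
  | or φ ψ ih ih' => simp only [map, Holds, ih, ih']

theorem vars_map (f : V → V') (φ : PFormula V) : (φ.map f).vars = f '' φ.vars := by
  induction φ with
  | eq x y => simp [map, vars, Set.image_pair]
  | and φ ψ ih ih' => simp only [map, vars, ih, ih', Set.image_union]
  | or φ ψ ih ih' => simp only [map, vars, ih, ih', Set.image_union]

theorem holds_toFormula {A : Type*} (num : V → ℕ) (φ : PFormula V) (ε : ℕ → A) :
    (φ.toFormula num).Holds ε ↔ φ.Holds (ε ∘ num) := by
  induction φ with
  | eq x y => exact Iff.rfl
  | and φ ψ ih ih' => simp only [toFormula, Formula.Holds, Holds, ih, ih']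
  | or φ ψ ih ih' => simp only [toFormula, Formula.Holds, Holds, ih, ih']

theorem freeVars_toFormula (num : V → ℕ) (φ : PFormula V) :
    (φ.toFormula num).freeVars = num '' φ.vars := by
  induction φ with
  | eq x y => simp [toFormula, vars, Formula.freeVars, Set.image_pair, Set.pair_comm]
  | and φ ψ ih ih' => simp only [toFormula, vars, Formula.freeVars, ih, ih', Set.image_union]
  | or φ ψ ih ih' => simp only [toFormula, vars, Formula.freeVars, ih, ih', Set.image_union]

theorem encode_toFormula (num : V → ℕ) (φ : PFormula V) :
    (φ.toFormula num).encode = φ.word id fun x => encodeVar (num x) := by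
  induction φ with
  | eq x y => simp [toFormula, Formula.encode, word]
  | and φ ψ ih ih' => simp only [toFormula, Formula.encode, word, ih, ih', id]
  | or φ ψ ih ih' => simp only [toFormula, Formula.encode, word, ih, ih', id]

end PFormula

/-- A quantifier, or a formula that is joined to the rest by `∧` (`assert`) or by `∨` (`alt`). -/
inductive Instr (V : Type) : Type
  | ex (x : V) : Instr V
  | all (x : V) : Instr V
  | assert (φ : PFormula V) : Instr V
  | alt (φ : PFormula V) : Instr V

namespace Instr

variable {V V' : Type}

def map (f : V → V') : Instr V → Instr V'
  | ex x => ex (f x)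
  | all x => all (f x)
  | assert φ => assert (φ.map f)
  | alt φ => alt (φ.map f)

def vars : Instr V → Set V
  | ex x => {x}
  | all x => {x}
  | assert φ => φ.vars
  | alt φ => φ.vars

theorem vars_map (f : V → V') (i : Instr V) : (i.map f).vars = f '' i.vars := by
  cases i <;> simp [map, vars, PFormula.vars_map]

def word {β : Type} (s : Letter eqLang → β) (t : V → List β) : Instr V → List β
  | ex x => s Letter.ex :: t x
  | all x => s Letter.all :: t x
  | assert φ => s Letter.and :: φ.word s t
  | alt φ => s Letter.or :: φ.word s t

open scoped Classical in
/-- Truth of the formula given by a list of instructions. -/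
noncomputable def Holds {A : Type*} : List (Instr V) → (V → A) → Prop
  | [], _ => True
  | ex x :: I, ρ => ∃ a, Holds I (Function.update ρ x a)
  | all x :: I, ρ => ∀ a, Holds I (Function.update ρ x a)
  | assert φ :: I, ρ => φ.Holds ρ ∧ Holds I ρ
  | alt φ :: I, ρ => φ.Holds ρ ∨ Holds I ρ

/-- The formula given by a list of instructions; it ends with `v = v`. -/
def toFormula (num : V → ℕ) (v : V) : List (Instr V) → Formula eqLang
  | [] => (PFormula.eq v v).toFormula num
  | ex x :: I => Formula.ex (num x) (toFormula num v I)
  | all x :: I => Formula.all (num x) (toFormula num v I)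
  | assert φ :: I => Formula.and (φ.toFormula num) (toFormula num v I)
  | alt φ :: I => Formula.or (φ.toFormula num) (toFormula num v I)

/-- Distinct variables need distinct numbers, so that a quantifier over one leaves the values of the
others unchanged. -/
theorem holds_toFormula {A : Type*} (num : V → ℕ) (hnum : Function.Injective num) (v : V)
    (I : List (Instr V)) (ε : ℕ → A) : (toFormula num v I).Holds ε ↔ Holds I (ε ∘ num) := by
  classical
  induction I generalizing ε with
  | nil => simp [toFormula, PFormula.holds_toFormula, Holds, PFormula.Holds]
  | cons i I ih =>
    cases i with
    | ex x =>
      simp only [toFormula, Formula.Holds, Holds, ih]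
      refine exists_congr fun a => ?_
      rw [Function.update_comp_eq_of_injective _ hnum]
    | all x =>
      simp only [toFormula, Formula.Holds, Holds, ih]
      refine forall_congr' fun a => ?_
      rw [Function.update_comp_eq_of_injective _ hnum]
    | assert φ => simp only [toFormula, Formula.Holds, Holds, ih, PFormula.holds_toFormula]
    | alt φ => simp only [toFormula, Formula.Holds, Holds, ih, PFormula.holds_toFormula]

theorem encode_toFormula (num : V → ℕ) (v : V) (I : List (Instr V)) :
    (toFormula num v I).encode = I.flatMap (word id fun x => encodeVar (num x)) ++
      (PFormula.eq v v).word id fun x => encodeVar (num x) := by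
  induction I with
  | nil => exact PFormula.encode_toFormula num _
  | cons i I ih =>
    cases i <;>
      simp [toFormula, Formula.encode, ih, word, PFormula.encode_toFormula]

theorem freeVars_toFormula_subset (num : V → ℕ) (v : V) (s : Set V) (hv : v ∈ s)
    (I : List (Instr V)) (hI : ∀ i ∈ I, i.vars ⊆ s) :
    (toFormula num v I).freeVars ⊆ num '' s := by
  induction I with
  | nil =>
    rw [toFormula, PFormula.freeVars_toFormula]
    exact Set.image_mono (by simp [PFormula.vars, hv])
  | cons i I ih =>
    have h1 := ih fun i hi => hI i (List.mem_cons_of_mem _ hi)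
    have h2 := hI i List.mem_cons_self
    cases i with
    | ex x => exact Set.sdiff_subset.trans h1
    | all x => exact Set.sdiff_subset.trans h1
    | assert φ =>
      exact Set.union_subset (by rw [PFormula.freeVars_toFormula]; exact Set.image_mono h2) h1
    | alt φ =>
      exact Set.union_subset (by rw [PFormula.freeVars_toFormula]; exact Set.image_mono h2) h1

theorem freeVars_toFormula_exs (num : V → ℕ) (v : V) (I : List (Instr V)) (l : List V) :
    (toFormula num v (l.map ex ++ I)).freeVars = (toFormula num v I).freeVars \ num '' {x | x ∈ l} := by
  induction l with
  | nil => simp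
  | cons x l ih =>
    simp only [List.map_cons, List.cons_append, toFormula, Formula.freeVars, ih]
    ext k
    simp only [Set.mem_sdiff, Set.mem_image, Set.mem_ofPred_eq, Set.mem_singleton_iff, List.mem_cons]
    grind

/-- A formula that begins with the quantification of all variables is a sentence. -/
theorem isSentence_toFormula (num : V → ℕ) (a b : V) (l : List V)
    (I : List (Instr V)) (hI : ∀ i ∈ I, ∀ x ∈ i.vars, x = a ∨ x = b ∨ x ∈ l) :
    (toFormula num a (all a :: all b :: alt (PFormula.eq a b) :: (l.map ex ++ I))).IsSentence := by
  have h := freeVars_toFormula_subset num a {x | x = a ∨ x = b ∨ x ∈ l} (Or.inl rfl) I hI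
  rw [Formula.IsSentence, Set.eq_empty_iff_forall_notMem]
  intro k hk
  simp only [toFormula, Formula.freeVars, freeVars_toFormula_exs, PFormula.freeVars_toFormula,
    PFormula.vars, Set.mem_sdiff, Set.mem_union, Set.mem_image, Set.mem_insert_iff,
    Set.mem_singleton_iff, Set.mem_ofPred_eq] at hk
  obtain ⟨⟨⟨x, rfl | rfl, rfl⟩ | ⟨h1, h2⟩, hb⟩, ha⟩ := hk
  · exact ha rfl
  · exact hb rfl
  · obtain ⟨x, rfl | rfl | hx, rfl⟩ := h h1
    · exact ha rfl
    · exact hb rfl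
    · exact h2 ⟨x, hx, rfl⟩

theorem holds_exs {A : Type*} (l : List V) (I : List (Instr V)) (ρ : V → A) :
    Holds (l.map ex ++ I) ρ ↔ ∃ ρ' : V → A, (∀ x, x ∉ l → ρ' x = ρ x) ∧ Holds I ρ' := by
  classical
  induction l generalizing ρ with
  | nil =>
    refine ⟨fun h => ⟨ρ, fun _ _ => rfl, h⟩, fun ⟨ρ', h, h'⟩ => ?_⟩
    obtain rfl : ρ' = ρ := funext fun x => h x (by simp)
    exact h'
  | cons y l ih =>
    simp only [List.map_cons, List.cons_append, Holds, ih]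
    constructor
    · rintro ⟨a, ρ', h, h'⟩
      refine ⟨ρ', fun x hx => ?_, h'⟩
      simp only [List.mem_cons, not_or] at hx
      rw [h x hx.2, Function.update_of_ne hx.1]
    · rintro ⟨ρ', h, h'⟩
      -- The final value of `y` is a suitable witness even if `y` is quantified again in `l`.
      refine ⟨ρ' y, ρ', fun x hx => ?_, h'⟩
      by_cases hxy : x = y
      · subst hxy; simp
      · rw [Function.update_of_ne hxy]
        exact h x (by simp [hxy, hx])

theorem holds_asserts {A : Type*} (l : List (PFormula V)) (I : List (Instr V)) (ρ : V → A) :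
    Holds (l.map assert ++ I) ρ ↔ (∀ φ ∈ l, φ.Holds ρ) ∧ Holds I ρ := by
  induction l with
  | nil => simp
  | cons φ l ih => simp [Holds, ih, and_assoc]

end Instr

/-! ### Templates -/

section Templates

variable {G F : Type}

/-- Add `j` to the index of an indexed variable. -/
def shift (j : ℕ) : G ⊕ ℕ × F → G ⊕ ℕ × F := Sum.map id (Prod.map (· + j) id)

/-- The list of instructions of a section, which is written once or `S` times. -/
def instSection (S : ℕ) (s : Bool × List (Instr (G ⊕ ℕ × F))) : List (Instr (G ⊕ ℕ × F)) :=
  if s.1 then (List.range S).flatMap fun j => s.2.map (Instr.map (shift j))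
  else s.2.map (Instr.map (shift 0))

variable [Finite G] [Finite F]

noncomputable def index (X : Type) [Finite X] : X ≃ Fin (Nat.card X) := Finite.equivFin X

/-- The number of a variable. -/
noncomputable def varNum : G ⊕ ℕ × F → ℕ
  | .inl g => index G g
  | .inr (j, f) => Nat.card G + (index F f + Nat.card F * j)

/-- Global variables take the numbers below `Nat.card G`; the others are recovered by division with
remainder by `Nat.card F`. -/
theorem varNum_injective : Function.Injective (varNum (G := G) (F := F)) := by
  rintro (g | ⟨j, f⟩) (g' | ⟨j', f'⟩) h <;> simp only [varNum] at h
  · rw [(index G).injective (Fin.ext h)]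
  · have := (index G g).2; omega
  · have := (index G g').2; omega
  · have hf := (index F f).2
    have hf' := (index F f').2
    have h := Nat.add_left_cancel h
    have h1 : j = j' := by
      have := congrArg (· / Nat.card F) h
      simpa [Nat.add_mul_div_left _ _ (by omega : 0 < Nat.card F), Nat.div_eq_of_lt hf,
        Nat.div_eq_of_lt hf'] using this
    subst h1
    rw [(index F).injective (Fin.ext (Nat.add_right_cancel h))]

/-- A variable as a template for words. -/
noncomputable def symVar : G ⊕ ℕ × F → List (Option (Letter eqLang))
  | .inl g => (encodeVar (index G g)).map some
  | .inr (j, f) => none :: (encodeVar (Nat.card G + (index F f + Nat.card F * j))).map some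

/-- The word for which `none` stands in templates. -/
noncomputable def unit (F : Type) : List (Letter eqLang) := List.replicate (Nat.card F) Letter.stroke

theorem expand_append {β : Type} (u : List β) (j : ℕ) (T T' : List (Option β)) :
    Frag.expand u j (T ++ T') = Frag.expand u j T ++ Frag.expand u j T' :=
  List.flatMap_append

theorem expand_some {β : Type} (u : List β) (j : ℕ) (b : β) (T : List (Option β)) :
    Frag.expand u j (some b :: T) = b :: Frag.expand u j T := rfl

theorem expand_none {β : Type} (u : List β) (j : ℕ) (T : List (Option β)) :
    Frag.expand u j (none :: T) = ((List.range j).flatMap fun _ => u) ++ Frag.expand u j T := rfl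

theorem expand_map_some {β : Type} (u : List β) (j : ℕ) (l : List β) :
    Frag.expand u j (l.map some) = l := by
  induction l with
  | nil => rfl
  | cons b l ih => rw [List.map_cons, expand_some, ih]

theorem flatMap_replicate {β : Type} (b : β) (j k : ℕ) :
    ((List.range j).flatMap fun _ => List.replicate k b) = List.replicate (k * j) b := by
  induction j with
  | zero => simp
  | succ j ih =>
    rw [List.range_succ, List.flatMap_append, ih]
    simp [Nat.mul_succ]

/-- Raising an array index by `j` adds `Nat.card F * j` to the number of the variable, which in
unary notation is `j` more copies of the block `unit F`. This is why a loop with running index `j`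
can write shifted formulas. -/
theorem expand_symVar (j : ℕ) (x : G ⊕ ℕ × F) :
    Frag.expand (unit F) j (symVar x) = encodeVar (varNum (shift j x)) := by
  rcases x with g | ⟨i, f⟩
  · exact expand_map_some _ _ _
  · simp only [symVar, expand_none, expand_map_some, shift, Sum.map_inr, Prod.map, varNum, unit,
      flatMap_replicate, encodeVar, ← List.append_assoc, ← List.replicate_add, id]
    congr 2
    ring

theorem expand_word_pformula (j : ℕ) (φ : PFormula (G ⊕ ℕ × F)) :
    Frag.expand (unit F) j (φ.word some symVar) =
      (φ.map (shift j)).word id fun x => encodeVar (varNum x) := by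
  induction φ with
  | eq x y => simp only [PFormula.word, PFormula.map, expand_some, expand_append, expand_symVar, id]
  | and φ ψ ih ih' => simp only [PFormula.word, PFormula.map, expand_some, expand_append, ih, ih', id]
  | or φ ψ ih ih' => simp only [PFormula.word, PFormula.map, expand_some, expand_append, ih, ih', id]

theorem expand_word_instr (j : ℕ) (i : Instr (G ⊕ ℕ × F)) :
    Frag.expand (unit F) j (i.word some symVar) =
      (i.map (shift j)).word id fun x => encodeVar (varNum x) := by
  cases i <;>
    simp only [Instr.word, Instr.map, expand_some, expand_symVar, expand_word_pformula, id]

/-- The word template of a list of instructions. -/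
noncomputable def symWord (I : List (Instr (G ⊕ ℕ × F))) : List (Option (Letter eqLang)) :=
  I.flatMap fun i => i.word some symVar

theorem expand_symWord (j : ℕ) (I : List (Instr (G ⊕ ℕ × F))) :
    Frag.expand (unit F) j (symWord I) =
      (I.map (Instr.map (shift j))).flatMap (Instr.word id fun x => encodeVar (varNum x)) := by
  induction I with
  | nil => rfl
  | cons i I ih =>
    rw [symWord, List.flatMap_cons, expand_append, expand_word_instr, List.map_cons,
      List.flatMap_cons, ← ih, symWord]

theorem sectionOut_symWord (S : ℕ) (s : Bool × List (Instr (G ⊕ ℕ × F))) :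
    Frag.sectionOut (unit F) S (s.1, symWord s.2) =
      (instSection S s).flatMap (Instr.word id fun x => encodeVar (varNum x)) := by
  unfold Frag.sectionOut instSection
  split_ifs
  · simp only [expand_symWord, List.flatMap_assoc]
  · exact expand_symWord _ _

theorem sectionsOut_symWord (S : ℕ) (L : List (Bool × List (Instr (G ⊕ ℕ × F)))) :
    (L.map fun s => (s.1, symWord s.2)).flatMap (Frag.sectionOut (unit F) S) =
      (L.flatMap (instSection S)).flatMap (Instr.word id fun x => encodeVar (varNum x)) := by
  rw [List.flatMap_map, List.flatMap_assoc]
  exact congrArg (L.flatMap ·) (funext fun s => sectionOut_symWord S s)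

/-- The instructions of the sentence that is written by the program of word templates. -/
def sentenceInstrs {α : Type} (L₁ : List (Bool × List (Instr (G ⊕ ℕ × F))))
    (T T' : InSym α → List (Instr (G ⊕ ℕ × F)))
    (L₂ L₃ L₄ : List (Bool × List (Instr (G ⊕ ℕ × F)))) (S : ℕ) (w : List α) :
    List (Instr (G ⊕ ℕ × F)) :=
  L₁.flatMap (instSection S) ++ (instSection S (false, T (Transducer.readInput w 1)) ++
    (((List.range S).flatMap fun j =>
        (T' (Transducer.readInput w (j + 2))).map (Instr.map (shift j))) ++
      (L₂.flatMap (instSection S) ++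
        (((List.range S).flatMap fun _ => L₃.flatMap (instSection S)) ++
          L₄.flatMap (instSection S)))))

theorem logspaceComputable_sentenceInstrs {α : Type} [Finite α] (C : ℕ) (hC : 0 < C) (g : G)
    (L₁ : List (Bool × List (Instr (G ⊕ ℕ × F))))
    (T T' : InSym α → List (Instr (G ⊕ ℕ × F)))
    (L₂ L₃ L₄ : List (Bool × List (Instr (G ⊕ ℕ × F)))) :
    LogspaceComputable fun w : List α => (Instr.toFormula varNum (Sum.inl g)
      (sentenceInstrs L₁ T T' L₂ L₃ L₄ ((w.length + 1 + C) ^ C) w)).encode := by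
  have h := logspaceComputable_programOut C hC (unit F) (L₁.map fun s => (s.1, symWord s.2))
    (fun a => symWord (T a)) (fun a => symWord (T' a)) (L₂.map fun s => (s.1, symWord s.2))
    (L₃.map fun s => (s.1, symWord s.2))
    -- The closing equation `v = v` of the formula is treated as one more section.
    ((L₄.map fun s => (s.1, symWord s.2)) ++
      [(false, (PFormula.eq (Sum.inl g) (Sum.inl g) : PFormula (G ⊕ ℕ × F)).word some symVar)])
  convert h using 2 with w
  simp only [Instr.encode_toFormula, Frag.programOut, sentenceInstrs, List.flatMap_append,
    sectionsOut_symWord, expand_symWord, List.append_assoc, List.flatMap_assoc, instSection,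
    Bool.false_eq_true, if_false]
  simp only [Frag.sectionOut, List.flatMap_cons, List.flatMap_nil, expand_word_pformula,
    List.append_nil, Bool.false_eq_true, if_false]
  rfl

end Templates
end PromiseMC

namespace PromiseMC
namespace TM

/-! ### Turing machine runs as cellular automaton runs -/

variable {α : Type} (M : TM α)

/-- One step, where halted configurations are repeated. -/
def next (c : M.Cfg) : M.Cfg := (M.step c).getD c

/-- The contents of a cell: `none` is the left border, and other cells have a tape symbol and
possibly the state of the head that scans them. -/
abbrev Cell := Option (M.Γ × Option M.Q)

/-- The cells of a configuration, shifted by one because of the border. -/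
def cells (c : M.Cfg) : ℕ → M.Cell
  | 0 => none
  | j + 1 => some (c.tape j, open scoped Classical in if c.head = j then some c.state else none)

/-- The state that a head on the given cell takes to the neighbour in the direction `d`. -/
def sends (d : Move) : M.Cell → Option M.Q
  | some (g, some q) => match d, M.δ q g with
    | .left, some (q', _, .left) => some q'
    | .right, some (q', _, .right) => some q'
    | _, _ => none
  | _ => none

/-- The contents of a cell after a step, from the contents of its neighbourhood. -/
def localRule (l x r : M.Cell) : M.Cell :=
  match x with
  | none => none
  | some (g, some q) => match M.δ q g with
    | none => some (g, some q)
    | some (q', g', .stay) => some (g', some q')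
    | some (q', g', .left) => some (g', if l.isNone then some q' else none)
    | some (_, g', .right) => some (g', none)
  | some (g, none) => some (g, (M.sends .right l).or (M.sends .left r))

/-- One step of the cellular automaton with local rule `f` on the cells `1, …, S`. -/
def _root_.PromiseMC.automaton {K : Type} (f : K → K → K → K) (S : ℕ) (x : ℕ → K) (j : ℕ) : K :=
  if 1 ≤ j ∧ j ≤ S then f (x (j - 1)) (x j) (x (j + 1)) else x j

/-- A head moves by at most one cell, so the neighbourhood determines the new contents. The bounds
on the head before and after the step ensure that nothing changes on the cells that the automaton
keeps frozen. -/
theorem automaton_cells (c : M.Cfg) (S : ℕ) (h : c.head < S) (h' : (M.next c).head < S) :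
    automaton M.localRule S (M.cells c) = M.cells (M.next c) := by
  classical
  funext j
  rcases j with _ | j
  · simp [automaton, cells]
  obtain ⟨q, p, t⟩ := c
  rcases hδ : M.δ q (t p) with _ | ⟨q', g', d⟩
  · have hn : M.next ⟨q, p, t⟩ = ⟨q, p, t⟩ := by simp [next, step, hδ]
    rw [hn]
    unfold automaton
    split_ifs with hj
    · have hs : ∀ d k, M.sends d (M.cells ⟨q, p, t⟩ k) = none := by
        intro d k
        rcases k with _ | k
        · rfl
        · by_cases hk : p = k
          · subst hk; simp [cells, sends, hδ]
          · simp [cells, sends, hk]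
      by_cases hp : p = j
      · subst hp; simp [cells, localRule, hδ]
      · have := hs .right j
        have := hs .left (j + 1 + 1)
        simp_all [cells, localRule]
    · rfl
  · have hn : M.next ⟨q, p, t⟩ = ⟨q', d.apply p, Function.update t p g'⟩ := by
      simp [next, step, hδ]
    rw [hn] at h' ⊢
    simp only at h h'
    unfold automaton
    split_ifs with hj
    · by_cases hp : p = j
      · subst hp
        cases d with
        -- A left move on tape cell `0` does not move the head; the local rule recognises this case
        -- by the border to the left.
        | left => cases p <;> simp [cells, localRule, hδ, Move.apply]
        | stay => simp [cells, localRule, hδ, Move.apply]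
        | right => simp [cells, localRule, hδ, Move.apply]
      · have h1 : M.sends .right (M.cells ⟨q, p, t⟩ j) =
            if p + 1 = j ∧ d = .right then some q' else none := by
          rcases j with _ | j
          · simp [cells, sends]
          · by_cases hk : p = j
            · subst hk; cases d <;> simp [cells, sends, hδ]
            · simp [cells, sends, hk]
        have h2 : M.sends .left (M.cells ⟨q, p, t⟩ (j + 1 + 1)) =
            if p = j + 1 ∧ d = .left then some q' else none := by
          by_cases hk : p = j + 1
          · subst hk; cases d <;> simp [cells, sends, hδ]
          · simp [cells, sends, hk]
        have h3 : M.cells ⟨q, p, t⟩ (j + 1) = some (t j, none) := by simp [cells, hp]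
        rw [Nat.add_sub_cancel, h3]
        simp only [localRule]
        rw [h1, h2]
        simp only [cells, Function.update_of_ne (Ne.symm hp)]
        clear h1 h2 h3 hn h'
        cases d with
        | left =>
          by_cases hk : p = j + 1
          · simp [Move.apply, hk]
          · simp [Move.apply, hk, show p - 1 ≠ j by omega]
        | stay => simp [Move.apply, hp]
        | right => by_cases hk : p + 1 = j <;> simp [Move.apply, hk]
    · have hj' : S ≤ j := by omega
      simp only [cells, Function.update_of_ne (show j ≠ p by omega)]
      rw [if_neg (by omega), if_neg (by omega)]

/-! ### Halting within exponentially many steps. -/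

theorem Reaches_iterate_next {c c' : M.Cfg} (h : StateTransition.Reaches M.step c c') :
    ∃ t, M.next^[t] c = c' := by
  induction h with
  | refl => exact ⟨0, rfl⟩
  | tail _ hs ih =>
    obtain ⟨t, rfl⟩ := ih
    refine ⟨t + 1, ?_⟩
    rw [Function.iterate_succ_apply', next, Option.mem_def.1 hs]
    rfl

theorem iterate_next_reaches (c : M.Cfg) (t : ℕ) :
    StateTransition.Reaches M.step c (M.next^[t] c) := by
  induction t with
  | zero => exact Relation.ReflTransGen.refl
  | succ t ih =>
    rw [Function.iterate_succ_apply']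
    rcases h : M.step (M.next^[t] c) with _ | c'
    · rwa [next, h]
    · rw [next, h]
      exact ih.tail h

theorem next_of_halted {c : M.Cfg} (h : M.step c = none) : M.next c = c := by simp [next, h]

/-- Cells that are never scanned are never written. -/
theorem tape_iterate_next (c : M.Cfg) (s : ℕ) (h : ∀ t, (M.next^[t] c).head < s) (t j : ℕ)
    (hj : s ≤ j) : (M.next^[t] c).tape j = c.tape j := by
  induction t with
  | zero => rfl
  | succ t ih =>
    rw [Function.iterate_succ_apply', ← ih]
    have := h t
    generalize M.next^[t] c = c' at this
    unfold next step
    cases M.δ c'.state (c'.tape c'.head) with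
    | none => rfl
    | some r => exact Function.update_of_ne (by omega) _ _

/-- A halting run in space `s` takes fewer than `2 ^ (k * s)` steps, where `k` is the number of possible
contents of a cell. -/
theorem halted_of_space (c : M.Cfg) (s S : ℕ) (h : ∀ t, (M.next^[t] c).head < s)
    (hS : Nat.card (M.Γ × Option M.Q) * s ≤ S) {t : ℕ} (ht : M.step (M.next^[t] c) = none) :
    M.next^[2 ^ S] c = M.next^[t] c := by
  classical
  have := M.finQ
  have := M.finΓ
  have stay : ∀ t, M.step (M.next^[t] c) = none → ∀ d, M.next^[t + d] c = M.next^[t] c := by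
    intro t ht d
    induction d with
    | zero => rfl
    | succ d ih => rw [← add_assoc, Function.iterate_succ_apply', ih, M.next_of_halted ht]
  have hex : ∃ t, M.step (M.next^[t] c) = none := ⟨t, ht⟩
  set t₀ := Nat.find hex with ht₀
  have h₀ : M.step (M.next^[t₀] c) = none := Nat.find_spec hex
  have hle : t₀ ≤ t := Nat.find_min' hex ht
  suffices hlt : t₀ ≤ 2 ^ S by
    have h1 := stay t₀ h₀ (t - t₀)
    have h2 := stay t₀ h₀ (2 ^ S - t₀)
    rw [Nat.add_sub_cancel' hle] at h1
    rw [Nat.add_sub_cancel' hlt] at h2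
    rw [h1, h2]
  -- If configuration `i` recurred at time `j`, cutting out the steps in between would give a halt
  -- before the first halting time `t₀`.
  have hinj : ∀ i j, i < j → j ≤ t₀ → M.next^[i] c ≠ M.next^[j] c := by
    intro i j hij hj he
    have : M.next^[t₀ - j + i] c = M.next^[t₀] c := by
      rw [Function.iterate_add_apply, he, ← Function.iterate_add_apply, Nat.sub_add_cancel hj]
    exact Nat.find_min hex (m := t₀ - j + i) (by omega) (by rw [this]; exact h₀)
  -- The first `s` cells, with the state recorded at the scanned one, determine the configuration,
  -- since the rest of the tape never changes. Pigeonhole then bounds `t₀`.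
  let f : Fin (t₀ + 1) → (Fin s → M.Γ × Option M.Q) := fun i j =>
    ((M.next^[i] c).tape j, if (M.next^[i] c).head = j then some (M.next^[i] c).state else none)
  have hf : Function.Injective f := by
    have cfg : ∀ i j : Fin (t₀ + 1), f i = f j → M.next^[i] c = M.next^[j] c := by
      intro i j hij
      have h1 := congrFun hij ⟨_, h i⟩
      have h2 : (M.next^[j] c).head = (M.next^[i] c).head ∧
          (M.next^[i] c).state = (M.next^[j] c).state := by
        have := congrArg Prod.snd h1
        simp only [f, if_true] at this
        split_ifs at this with hh
        exact ⟨hh, Option.some.inj this⟩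
      have h3 : (M.next^[i] c).tape = (M.next^[j] c).tape := by
        funext k
        by_cases hk : k < s
        · exact congrArg Prod.fst (congrFun hij ⟨k, hk⟩)
        · rw [M.tape_iterate_next c s h _ _ (by omega), M.tape_iterate_next c s h _ _ (by omega)]
      clear h1
      revert h2 h3
      generalize M.next^[i] c = a
      generalize M.next^[j] c = b
      rcases a with ⟨_, _, _⟩
      rcases b with ⟨_, _, _⟩
      rintro ⟨h1, h2⟩ h3
      simp_all
    intro i j hij
    by_contra hne
    rcases lt_or_gt_of_ne hne with hlt | hlt
    · exact hinj i j hlt (by omega) (cfg i j hij)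
    · exact hinj j i hlt (by omega) (cfg i j hij).symm
  have hcard := Nat.card_le_card_of_injective f hf
  rw [Nat.card_fun, Nat.card_eq_fintype_card, Fintype.card_fin, Nat.card_eq_fintype_card (α := Fin s),
    Fintype.card_fin] at hcard
  calc t₀ ≤ t₀ + 1 := Nat.le_succ _
    _ ≤ Nat.card (M.Γ × Option M.Q) ^ s := hcard
    _ ≤ (2 ^ Nat.card (M.Γ × Option M.Q)) ^ s := Nat.pow_le_pow_left Nat.lt_two_pow_self.le _
    _ = 2 ^ (Nat.card (M.Γ × Option M.Q) * s) := by rw [← pow_mul]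
    _ ≤ 2 ^ S := Nat.pow_le_pow_right (by norm_num) hS

theorem iterate_automaton_cells (c : M.Cfg) (S : ℕ) (h : ∀ t, (M.next^[t] c).head < S) (t : ℕ) :
    (automaton M.localRule S)^[t] (M.cells c) = M.cells (M.next^[t] c) := by
  induction t with
  | zero => rfl
  | succ t ih =>
    rw [Function.iterate_succ_apply', Function.iterate_succ_apply', ih, automaton_cells _ _ _ (h t)]
    rw [← Function.iterate_succ_apply' M.next]
    exact h (t + 1)

/-- The contents of a cell from which no rejecting state can be read off. -/
def Fine : M.Cell → Prop
  | some (_, some q) => q ∈ M.accept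
  | _ => True

/-- After `2 ^ S` steps the automaton shows the halting configuration. Only the scanned cell carries
a state, so the machine accepts exactly if no cell shows a rejecting state. -/
theorem mem_iff_fine {L : _root_.Language α} (hL : M.Decides L) {p : Polynomial ℕ}
    (hp : M.RunsInSpace fun n => p.eval n) (w : List α) (S : ℕ)
    (hS : Nat.card (M.Γ × Option M.Q) * p.eval w.length ≤ S) :
    w ∈ L ↔ ∀ j, 1 ≤ j → j ≤ S →
      M.Fine ((automaton M.localRule S)^[2 ^ S] (M.cells (M.init w)) j) := by
  have := M.finQ
  have := M.finΓ
  have : Nonempty M.Γ := ⟨M.blank⟩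
  obtain ⟨c, hr, hh, hc⟩ := hL w
  obtain ⟨t, rfl⟩ := M.Reaches_iterate_next hr
  have hs : ∀ t, (M.next^[t] (M.init w)).head < p.eval w.length := fun t =>
    hp w _ (M.iterate_next_reaches _ t)
  have hcard : 1 ≤ Nat.card (M.Γ × Option M.Q) := Nat.card_pos
  have hsS : p.eval w.length ≤ S := by nlinarith
  rw [iterate_automaton_cells _ _ _ fun t => (hs t).trans_le hsS,
    M.halted_of_space _ _ _ hs hS hh, ← hc]
  have ht := (hs t).trans_le hsS
  generalize M.next^[t] (M.init w) = c at ht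
  constructor
  · intro h j hj _
    obtain ⟨j, rfl⟩ : ∃ k, j = k + 1 := ⟨j - 1, by omega⟩
    by_cases hj : c.head = j
    · simpa [cells, hj, Fine] using h
    · simp [cells, hj, Fine]
  · intro h
    simpa [cells, Fine] using h (c.head + 1) (by omega) ht

end TM
end PromiseMC

namespace PromiseMC

/-! ### The game -/

noncomputable def elems (X : Type) [Finite X] : List X :=
  (@Finset.univ X (Fintype.ofFinite X)).toList

theorem mem_elems {X : Type} [Finite X] (x : X) : x ∈ elems X := by
  simp [elems]

/-- The games that are played in parallel are given by the functions from the `n` names of elements to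
the truth values. -/
abbrev World (n : ℕ) := Fin n → Bool

/-- Variables: the two constants and the challenge, the names of the elements, and one bit for each world;
five arrays with cells coded by bits, for each world. The arrays `0` and `1` are the current pair of
configurations, `2` is the configuration halfway, and `3` and `4` are the next pair. -/
abbrev GameVar (n : ℕ) (K : Type) := (Fin 3 ⊕ Fin n ⊕ World n) ⊕ ℕ × (Fin 5 × World n × K)

namespace Game

variable {n : ℕ} {K : Type}

def cst (t : Bool) : GameVar n K := .inl (.inl (if t then 1 else 0))
def chal : GameVar n K := .inl (.inl 2)
def name (e : Fin n) : GameVar n K := .inl (.inr (.inl e))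
def bit (W : World n) : GameVar n K := .inl (.inr (.inr W))
def cell (k : Fin 5) (j : ℕ) (W : World n) (r : K) : GameVar n K := .inr (j, k, W, r)

def conj (l : List (PFormula (GameVar n K))) : PFormula (GameVar n K) :=
  l.foldr .and (.eq (cst false) (cst false))

/-- Falsity is not expressible; the empty disjunction is an equation that fails whenever the two
constants differ, which is the case that matters for refuting the sentence. -/
def disj (l : List (PFormula (GameVar n K))) : PFormula (GameVar n K) :=
  l.foldr .or (.eq (cst false) (cst true))

theorem holds_conj {A : Type*} (l : List (PFormula (GameVar n K))) (ρ : GameVar n K → A) :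
    (conj l).Holds ρ ↔ ∀ φ ∈ l, φ.Holds ρ := by
  induction l with
  | nil => simp [conj, PFormula.Holds]
  | cons φ l ih => simp only [conj, List.foldr_cons, PFormula.Holds, List.forall_mem_cons] at ih ⊢; rw [ih]

theorem holds_disj {A : Type*} (l : List (PFormula (GameVar n K))) (ρ : GameVar n K → A) :
    (disj l).Holds ρ ↔ (∃ φ ∈ l, φ.Holds ρ) ∨ ρ (cst false) = ρ (cst true) := by
  induction l with
  | nil => simp [disj, PFormula.Holds]
  | cons φ l ih =>
    simp only [disj, List.foldr_cons, PFormula.Holds, List.exists_mem_cons_iff] at ih ⊢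
    rw [ih, or_assoc]

open scoped Classical in
/-- The cell `j` of the array `k` has contents `σ`. -/
noncomputable def isCell [Finite K] (k : Fin 5) (j : ℕ) (W : World n) (σ : K) : PFormula (GameVar n K) :=
  conj ((elems K).map fun r => .eq (cell k j W r) (cst (decide (r = σ))))

/-- The challenge is the element named `e`, and the bits are the values of `e` in the worlds. -/
noncomputable def challenge : PFormula (GameVar n K) :=
  disj ((elems (Fin n)).map fun e => .and (.eq chal (name e))
    (conj ((elems (World n)).map fun W => .eq (bit W) (cst (W e)))))

/-- The next pair is the first or the second half, depending on the bit. -/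
def chooseHalf (W : World n) (r : K) : PFormula (GameVar n K) :=
  .or
    (.and (.eq (bit W) (cst false))
      (.and (.eq (cell 3 1 W r) (cell 0 1 W r)) (.eq (cell 4 1 W r) (cell 2 1 W r))))
    (.and (.eq (bit W) (cst true))
      (.and (.eq (cell 3 1 W r) (cell 2 1 W r)) (.eq (cell 4 1 W r) (cell 1 1 W r))))

def copyPair (W : World n) (r : K) : PFormula (GameVar n K) :=
  .and (.eq (cell 0 1 W r) (cell 3 1 W r)) (.eq (cell 1 1 W r) (cell 4 1 W r))

/-- The indices `0, 1, 2` are relative: the surrounding section shifts the formula along the arrays.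
-/
noncomputable def localStep [Finite K] (f : K → K → K → K) (W : World n) : PFormula (GameVar n K) :=
  disj ((elems (K × K × K)).map fun p => .and (isCell 0 0 W p.1) (.and (isCell 0 1 W p.2.1)
    (.and (isCell 0 2 W p.2.2) (isCell 1 1 W (f p.1 p.2.1 p.2.2)))))

noncomputable def isOneOf [Finite K] (ok : K → Prop) (W : World n) : PFormula (GameVar n K) :=
  disj ((elems {σ // ok σ}).map fun σ : {σ // ok σ} => isCell 1 1 W σ.1)

/-- The variables of the cells with index `j` of some arrays. -/
noncomputable def cellVars [Finite K] (ks : List (Fin 5)) (j : ℕ) : List (GameVar n K) :=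
  ks.flatMap fun k => (elems (World n × K)).map fun p => cell k j p.1 p.2

noncomputable def overWorlds (φ : World n → PFormula (GameVar n K)) : List (Instr (GameVar n K)) :=
  ((elems (World n)).map φ).map .assert

noncomputable def overBits [Finite K] (φ : World n → K → PFormula (GameVar n K)) :
    List (Instr (GameVar n K)) :=
  ((elems (World n × K)).map fun p => φ p.1 p.2).map .assert

/-- One round of the game. -/
noncomputable def round [Finite K] : List (Bool × List (Instr (GameVar n K))) :=
  -- The array halfway is fixed before the challenge is known, so the same array has to serve for
  -- both halves.
  [(true, (cellVars [2] 1).map .ex),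
    (false, .all chal :: (((elems (World n)).map bit).map .ex ++ [.assert challenge])),
    -- Requantifying the arrays `0` and `1` discards their values, so the new pair is first stored
    -- in `3` and `4`. Thus all rounds have the same text.
    (true, (cellVars [3, 4] 1).map .ex), (true, overBits chooseHalf),
    (true, (cellVars [0, 1] 1).map .ex), (true, overBits copyPair)]

/-! #### Semantics of the sections -/

section Semantics

variable {A : Type*} {S : ℕ}

/-- `ρ'` differs from `ρ` only on the cells `1, …, S` of the arrays in `ks`. -/
def Same (S : ℕ) (ks : List (Fin 5)) (ρ ρ' : GameVar n K → A) : Prop :=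
  ∀ x, (∀ k j W r, k ∈ ks → 1 ≤ j → j ≤ S → x ≠ cell k j W r) → ρ' x = ρ x

theorem Same.inl {ks : List (Fin 5)} {ρ ρ' : GameVar n K → A} (h : Same S ks ρ ρ')
    (g : Fin 3 ⊕ Fin n ⊕ World n) : ρ' (.inl g) = ρ (.inl g) :=
  h _ fun _ _ _ _ _ _ _ he => by simp [cell] at he

theorem Same.cell {ks : List (Fin 5)} {ρ ρ' : GameVar n K → A} (h : Same S ks ρ ρ')
    {k : Fin 5} {j : ℕ} (hk : k ∈ ks → 1 ≤ j → ¬ j ≤ S) (W : World n) (r : K) :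
    ρ' (Game.cell k j W r) = ρ (Game.cell k j W r) := by
  refine h _ fun k' j' W' r' hk' hj hj' he => ?_
  simp only [Game.cell, Sum.inr.injEq, Prod.mk.injEq] at he
  obtain ⟨rfl, rfl, -⟩ := he
  exact hk hk' hj hj'

theorem mem_cellVars [Finite K] {ks : List (Fin 5)} {j : ℕ} {x : GameVar n K} :
    x ∈ cellVars ks j ↔ ∃ k ∈ ks, ∃ W r, x = cell k j W r := by
  simp only [cellVars, List.mem_flatMap, List.mem_map, Prod.exists]
  exact ⟨fun ⟨k, hk, W, r, _, h⟩ => ⟨k, hk, W, r, h.symm⟩,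
    fun ⟨k, hk, W, r, h⟩ => ⟨k, hk, W, r, mem_elems _, h.symm⟩⟩

theorem instSection_ex (l : List (GameVar n K)) :
    instSection S (true, l.map .ex) =
      ((List.range S).flatMap fun j => l.map (shift j)).map .ex := by
  simp [instSection, List.map_flatMap, Function.comp_def, Instr.map]

theorem holds_exCells [Finite K] (ks : List (Fin 5)) (I : List (Instr (GameVar n K))) (ρ : GameVar n K → A) :
    Instr.Holds (instSection S (true, (cellVars ks 1).map .ex) ++ I) ρ ↔
      ∃ ρ', Same S ks ρ ρ' ∧ Instr.Holds I ρ' := by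
  rw [instSection_ex, Instr.holds_exs]
  refine exists_congr fun ρ' => and_congr_left fun _ => forall_congr' fun x => ?_
  refine imp_congr_left ?_
  simp only [List.mem_flatMap, List.mem_range, List.mem_map, mem_cellVars, not_exists, not_and]
  constructor
  · rintro h k j W r hk hj hj' rfl
    refine h (j - 1) (by omega) (cell k 1 W r) ⟨k, hk, W, r, rfl⟩ ?_
    simp only [shift, cell, Sum.map_inr, Prod.map, id]
    rw [Nat.add_sub_cancel' hj]
  · rintro h j hj y ⟨k, hk, W, r, rfl⟩ rfl
    exact h k (1 + j) W r hk (by omega) (by omega) rfl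

theorem holds_asserts_section (l : List (PFormula (GameVar n K))) (I : List (Instr (GameVar n K)))
    (ρ : GameVar n K → A) :
    Instr.Holds (instSection S (true, l.map .assert) ++ I) ρ ↔
      (∀ j, j < S → ∀ φ ∈ l, φ.Holds (ρ ∘ shift j)) ∧ Instr.Holds I ρ := by
  have : instSection S (true, l.map .assert) =
      ((List.range S).flatMap fun j => l.map (PFormula.map (shift j))).map .assert := by
    simp [instSection, List.map_flatMap, Function.comp_def, Instr.map]
  rw [this, Instr.holds_asserts]
  refine and_congr_left fun _ => ?_
  simp only [List.mem_flatMap, List.mem_range, List.mem_map]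
  constructor
  · intro h j hj φ hφ
    rw [← PFormula.holds_map]
    exact h _ ⟨j, hj, φ, hφ, rfl⟩
  · rintro h _ ⟨j, hj, φ, hφ, rfl⟩
    rw [PFormula.holds_map]
    exact h j hj φ hφ

theorem holds_overBits [Finite K] (φ : World n → K → PFormula (GameVar n K)) (I : List (Instr (GameVar n K)))
    (ρ : GameVar n K → A) :
    Instr.Holds (instSection S (true, overBits φ) ++ I) ρ ↔
      (∀ j, j < S → ∀ W r, (φ W r).Holds (ρ ∘ shift j)) ∧ Instr.Holds I ρ := by
  rw [overBits, holds_asserts_section]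
  simp only [List.forall_mem_map, mem_elems, forall_const, Prod.forall]

theorem holds_overWorlds (φ : World n → PFormula (GameVar n K)) (I : List (Instr (GameVar n K)))
    (ρ : GameVar n K → A) :
    Instr.Holds (instSection S (true, overWorlds φ) ++ I) ρ ↔
      (∀ j, j < S → ∀ W, (φ W).Holds (ρ ∘ shift j)) ∧ Instr.Holds I ρ := by
  rw [overWorlds, holds_asserts_section]
  simp only [List.forall_mem_map, mem_elems, forall_const]

open scoped Classical in
/-- Under `ρ`, the cell `j` of the array `k` has contents `σ`. -/
def Codes (ρ : GameVar n K → A) (k : Fin 5) (j : ℕ) (W : World n) (σ : K) : Prop :=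
  ∀ r, ρ (cell k j W r) = ρ (cst (decide (r = σ)))

theorem holds_isCell [Finite K] (ρ : GameVar n K → A) (i : ℕ) (k : Fin 5) (j : ℕ) (W : World n) (σ : K) :
    (isCell k j W σ).Holds (ρ ∘ shift i) ↔ Codes ρ k (j + i) W σ := by
  rw [isCell, holds_conj]
  simp only [List.forall_mem_map, mem_elems, forall_const]
  exact Iff.rfl

/-- In this one-hot code, the bit at `σ` is set for `σ` and for no other contents. -/
theorem Codes.unique {ρ : GameVar n K → A} (h : ρ (cst false) ≠ ρ (cst true)) {k : Fin 5} {j : ℕ}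
    {W : World n} {σ σ' : K} (hσ : Codes ρ k j W σ) (hσ' : Codes ρ k j W σ') : σ = σ' := by
  by_contra hne
  have := (hσ σ).symm.trans (hσ' σ)
  simp only [decide_true, hne, decide_false] at this
  exact h this.symm

/-- How a round changes the valuation, where `z` is the array halfway and `e` the name of the
challenge. -/
structure RoundStep (S : ℕ) (ρ : GameVar n K → A) (z : ℕ → World n → K → A) (e : Fin n)
    (ρ' : GameVar n K → A) : Prop where
  cst : ∀ t, ρ' (cst t) = ρ (cst t)
  name : ∀ d, ρ' (name d) = ρ (name d)
  outside : ∀ j W r, ¬ (1 ≤ j ∧ j ≤ S) → ρ' (cell 0 j W r) = ρ (cell 0 j W r)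
  first : ∀ j W r, 1 ≤ j → j ≤ S → ρ' (cell 0 j W r) = if W e then z j W r else ρ (cell 0 j W r)
  second : ∀ j W r, 1 ≤ j → j ≤ S → ρ' (cell 1 j W r) = if W e then ρ (cell 1 j W r) else z j W r

theorem holds_round [Finite K] (I : List (Instr (GameVar n K))) (ρ : GameVar n K → A) :
    Instr.Holds (round.flatMap (instSection S) ++ I) ρ ↔
      ∃ ρ₁, Same S [2] ρ ρ₁ ∧ ∀ y, ∃ ρ₂ : GameVar n K → A,
        (ρ₂ chal = y ∧ ∀ x, x ≠ chal → (∀ W, x ≠ bit W) → ρ₂ x = ρ₁ x) ∧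
        challenge.Holds ρ₂ ∧ ∃ ρ₃, Same S [3, 4] ρ₂ ρ₃ ∧
          (∀ j, j < S → ∀ W r, (chooseHalf W r).Holds (ρ₃ ∘ shift j)) ∧
          ∃ ρ₄, Same S [0, 1] ρ₃ ρ₄ ∧ (∀ j, j < S → ∀ W r, (copyPair W r).Holds (ρ₄ ∘ shift j)) ∧
            Instr.Holds I ρ₄ := by
  classical
  simp only [round, List.flatMap_cons, List.flatMap_nil, List.append_nil, List.append_assoc]
  rw [holds_exCells]
  refine exists_congr fun ρ₁ => and_congr_right fun _ => ?_
  have hshift : (shift 0 : GameVar n K → GameVar n K) = id := by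
    funext x; rcases x with _ | ⟨_, _⟩ <;> rfl
  have hbits : (((elems (World n)).map (bit (K := K))).map Instr.ex).map (Instr.map (shift 0)) =
      ((elems (World n)).map bit).map Instr.ex := by
    simp [Function.comp_def, Instr.map, hshift]
  have hch : ∀ ρ : GameVar n K → A, (challenge.map (shift 0)).Holds ρ ↔ challenge.Holds ρ := by
    intro ρ; rw [PFormula.holds_map, hshift]; rfl
  have hsec : instSection S (false, Instr.all (chal (n := n) (K := K)) ::
      (((elems (World n)).map bit).map .ex ++ [.assert challenge])) =
      Instr.all chal :: (((elems (World n)).map bit).map .ex ++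
        [.assert (challenge.map (shift 0))]) := by
    simp only [instSection, Bool.false_eq_true, if_false, List.map_cons, List.map_append, hbits,
      List.map_nil]
    rfl
  simp only [hsec, List.cons_append, List.append_assoc, List.nil_append, Instr.Holds]
  refine forall_congr' fun y => ?_
  rw [Instr.holds_exs]
  refine exists_congr fun ρ₂ => and_congr ?_ ?_
  · constructor
    · intro h
      refine ⟨?_, fun x hx hb => ?_⟩
      · rw [h _ (by simp [chal, bit])]; exact Function.update_self ..
      · rw [h _ (by simpa using fun W _ => (hb W).symm), Function.update_of_ne hx]
    · rintro ⟨h1, h2⟩ x hx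
      by_cases hc : x = chal
      · subst hc; rw [h1, Function.update_self]
      · rw [Function.update_of_ne hc]
        refine h2 x hc fun W hW => hx ?_
        rw [hW]
        exact List.mem_map_of_mem (mem_elems W)
  · simp only [Instr.Holds]
    rw [hch]
    refine and_congr_right fun _ => ?_
    rw [holds_exCells]
    refine exists_congr fun ρ₃ => and_congr_right fun _ => ?_
    rw [holds_overBits]
    refine and_congr_right fun _ => ?_
    rw [holds_exCells]
    refine exists_congr fun ρ₄ => and_congr_right fun _ => ?_
    rw [holds_overBits]

/-- The array `z` is obtained before `y` is introduced. Distinct constants rule out the degenerate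
disjunct of `challenge` and leave no freedom in the choice of the half. -/
theorem round_elim [Finite K] {I : List (Instr (GameVar n K))} {ρ : GameVar n K → A}
    (hρ : ρ (cst false) ≠ ρ (cst true))
    (h : Instr.Holds (round.flatMap (instSection S) ++ I) ρ) :
    ∃ z, ∀ y, ∃ e ρ', ρ (name e) = y ∧ RoundStep S ρ z e ρ' ∧ Instr.Holds I ρ' := by
  rw [holds_round] at h
  obtain ⟨ρ₁, h1, h⟩ := h
  refine ⟨fun j W r => ρ₁ (cell 2 j W r), fun y => ?_⟩
  obtain ⟨ρ₂, ⟨hy, h2⟩, hch, ρ₃, h3, hhalf, ρ₄, h4, hcopy, hI⟩ := h y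
  have g2 : ∀ t, ρ₂ (cst t) = ρ (cst t) := fun t => by
    rw [h2 _ (by cases t <;> simp [cst, chal]) (by simp [cst, bit])]; exact h1.inl _
  have n2 : ∀ e, ρ₂ (name e) = ρ (name e) := fun e => by
    rw [h2 _ (by simp [name, chal]) (by simp [name, bit])]; exact h1.inl _
  have c2 : ∀ k j W r, ρ₂ (cell k j W r) = ρ₁ (cell k j W r) := fun k j W r =>
    h2 _ (by simp [cell, chal]) (by simp [cell, bit])
  rw [challenge, holds_disj] at hch
  rcases hch with ⟨φ, hφ, hch⟩ | hch
  swap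
  · rw [g2, g2] at hch; exact absurd hch hρ
  rw [List.mem_map] at hφ
  obtain ⟨e, -, rfl⟩ := hφ
  obtain ⟨he, hbits⟩ := hch
  rw [holds_conj] at hbits
  have hbit : ∀ W, ρ₂ (bit W) = ρ (cst (W e)) := fun W => by
    rw [← g2]
    exact hbits _ (List.mem_map_of_mem (mem_elems W))
  refine ⟨e, ρ₄, ?_, ?_, hI⟩
  · rw [← hy, ← n2]; exact he.symm
  have key : ∀ j W r, 1 ≤ j → j ≤ S →
      ρ₃ (cell 3 j W r) = (if W e then ρ₁ (cell 2 j W r) else ρ (cell 0 j W r)) ∧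
      ρ₃ (cell 4 j W r) = if W e then ρ (cell 1 j W r) else ρ₁ (cell 2 j W r) := by
    intro j W r hj hj'
    have := hhalf (j - 1) (by omega) W r
    -- The bit of the world is the constant for `W e`, so the disjunct of `chooseHalf` that holds is
    -- the one for `W e`.
    have hb : ∀ t, ρ₃ (bit W) = ρ₃ (cst t) → W e = t := by
      intro t ht
      rw [show ρ₃ (bit W) = ρ₂ (bit W) from h3.inl _,
        show ρ₃ (cst t) = ρ₂ (cst t) from h3.inl _, hbit, g2] at ht
      cases hW : W e <;> cases t <;> rw [hW] at ht
      · exact absurd ht hρ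
      · exact absurd ht.symm hρ
    have e0 : ρ₃ (cell 0 j W r) = ρ (cell 0 j W r) := by
      rw [h3.cell (by simp), c2, h1.cell (by simp)]
    have e1 : ρ₃ (cell 1 j W r) = ρ (cell 1 j W r) := by
      rw [h3.cell (by simp), c2, h1.cell (by simp)]
    have e2 : ρ₃ (cell 2 j W r) = ρ₁ (cell 2 j W r) := by
      rw [h3.cell (by simp), c2]
    have ej : 1 + (j - 1) = j := Nat.add_sub_cancel' hj
    have hsh : ∀ k, (shift (j - 1) (cell k 1 W r) : GameVar n K) = cell k j W r := by
      intro k; simp only [shift, cell, Sum.map_inr, Prod.map, ej, id]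
    simp only [chooseHalf, PFormula.Holds, Function.comp_apply, hsh] at this
    rcases this with ⟨h, h', h''⟩ | ⟨h, h', h''⟩
    · rw [hb false h, h', h'', e0, e2]; simp
    · rw [hb true h, h', h'', e1, e2]; simp
  have copy : ∀ j W r, 1 ≤ j → j ≤ S →
      ρ₄ (cell 0 j W r) = ρ₃ (cell 3 j W r) ∧ ρ₄ (cell 1 j W r) = ρ₃ (cell 4 j W r) := by
    intro j W r hj hj'
    have := hcopy (j - 1) (by omega) W r
    have ej : 1 + (j - 1) = j := Nat.add_sub_cancel' hj
    have hsh : ∀ k, (shift (j - 1) (cell k 1 W r) : GameVar n K) = cell k j W r := by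
      intro k; simp only [shift, cell, Sum.map_inr, Prod.map, ej, id]
    simp only [copyPair, PFormula.Holds, Function.comp_apply, hsh] at this
    rwa [h4.cell (k := 3) (by simp), h4.cell (k := 4) (by simp)] at this
  constructor
  · exact fun t => ((h4.inl _).trans (h3.inl _)).trans (g2 t)
  · exact fun e => ((h4.inl _).trans (h3.inl _)).trans (n2 e)
  · intro j W r hj
    rw [h4.cell (by tauto), h3.cell (by simp), c2, h1.cell (by simp)]
  · intro j W r hj hj'
    rw [(copy j W r hj hj').1, (key j W r hj hj').1]
  · intro j W r hj hj'
    rw [(copy j W r hj hj').2, (key j W r hj hj').2]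

/-- Overwrite the cells `1, …, S` of the arrays in `ks`. -/
def setCells (S : ℕ) (ks : List (Fin 5)) (val : Fin 5 → ℕ → World n → K → A) (ρ : GameVar n K → A) :
    GameVar n K → A
  | .inl g => ρ (.inl g)
  | .inr (j, k, W, r) => if k ∈ ks ∧ 1 ≤ j ∧ j ≤ S then val k j W r else ρ (.inr (j, k, W, r))

theorem same_setCells (ks : List (Fin 5)) (val : Fin 5 → ℕ → World n → K → A)
    (ρ : GameVar n K → A) : Same S ks ρ (setCells S ks val ρ) := by
  rintro (g | ⟨j, k, W, r⟩) h
  · rfl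
  · exact if_neg fun h' => h k j W r h'.1 h'.2.1 h'.2.2 rfl

theorem setCells_cell {ks : List (Fin 5)} (val : Fin 5 → ℕ → World n → K → A)
    (ρ : GameVar n K → A) {k : Fin 5} (hk : k ∈ ks) {j : ℕ} (hj : 1 ≤ j) (hj' : j ≤ S) (W : World n)
    (r : K) : setCells S ks val ρ (cell k j W r) = val k j W r :=
  if_pos ⟨hk, hj, hj'⟩

/-- A strategy for the round is an array halfway together with a name for each challenge.
`RoundStep` records all that the continuation may rely on; the constants may coincide here. -/
theorem round_intro [Finite K] {I : List (Instr (GameVar n K))} {ρ : GameVar n K → A}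
    (z : ℕ → World n → K → A)
    (h : ∀ y, ∃ e, ρ (name e) = y ∧ ∀ ρ', RoundStep S ρ z e ρ' → Instr.Holds I ρ') :
    Instr.Holds (round.flatMap (instSection S) ++ I) ρ := by
  rw [holds_round]
  refine ⟨setCells S [2] (fun _ => z) ρ, same_setCells _ _ _, fun y => ?_⟩
  obtain ⟨e, he, h⟩ := h y
  set ρ₁ := setCells S [2] (fun _ => z) ρ with hρ₁
  have s1 : Same S [2] ρ ρ₁ := same_setCells _ _ _
  let ρ₂ : GameVar n K → A := fun x => match x with
    | .inl (.inl 2) => y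
    | .inl (.inr (.inr W)) => ρ (cst (W e))
    | x => ρ₁ x
  have g2 : ∀ t, ρ₂ (cst t) = ρ (cst t) := fun t => by cases t <;> rfl
  -- The next pair: its first component fills the arrays `3` and `0`, its second component the
  -- arrays `4` and `1`.
  let val : Fin 5 → ℕ → World n → K → A := fun k j W r =>
    if k = 0 ∨ k = 3 then (if W e then z j W r else ρ (cell 0 j W r))
    else (if W e then ρ (cell 1 j W r) else z j W r)
  set ρ₃ := setCells S [3, 4] val ρ₂ with hρ₃
  have s3 : Same S [3, 4] ρ₂ ρ₃ := same_setCells _ _ _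
  set ρ₄ := setCells S [0, 1] val ρ₃ with hρ₄
  have s4 : Same S [0, 1] ρ₃ ρ₄ := same_setCells _ _ _
  have hsh : ∀ k j W r, (shift j (cell k 1 W r) : GameVar n K) = cell k (1 + j) W r :=
    fun _ _ _ _ => rfl
  refine ⟨ρ₂, ⟨rfl, ?_⟩, ?_, ρ₃, s3, ?_, ρ₄, s4, ?_, h ρ₄ ?_⟩
  · rintro ((i | d | W) | x) hc hb
    · fin_cases i
      · rfl
      · rfl
      · exact absurd rfl hc
    · rfl
    · exact absurd rfl (hb W)
    · rfl
  · rw [challenge, holds_disj]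
    refine Or.inl ⟨_, List.mem_map_of_mem (mem_elems e), he.symm, ?_⟩
    rw [holds_conj]
    simp only [List.forall_mem_map]
    intro W _
    exact (g2 (W e)).symm
  · intro j hj W r
    have c : ∀ k, k ≠ 3 → k ≠ 4 → ρ₃ (cell k (1 + j) W r) = ρ₁ (cell k (1 + j) W r) :=
      fun k hk hk' => s3.cell (by simp [hk, hk']) W r
    have c0 : ρ₃ (cell 0 (1 + j) W r) = ρ (cell 0 (1 + j) W r) := by
      rw [c 0 (by decide) (by decide), s1.cell (by simp)]
    have c1 : ρ₃ (cell 1 (1 + j) W r) = ρ (cell 1 (1 + j) W r) := by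
      rw [c 1 (by decide) (by decide), s1.cell (by simp)]
    have c2 : ρ₃ (cell 2 (1 + j) W r) = z (1 + j) W r := by
      rw [c 2 (by decide) (by decide), hρ₁, setCells_cell _ _ (by simp) (by omega) (by omega)]
    have c3 := setCells_cell (S := S) (ks := [3, 4]) val ρ₂ (k := 3) (by simp) (j := 1 + j) (by omega)
      (by omega) W r
    have c4 := setCells_cell (S := S) (ks := [3, 4]) val ρ₂ (k := 4) (by simp) (j := 1 + j) (by omega)
      (by omega) W r
    rw [← hρ₃] at c3 c4
    have cb : ρ₃ (bit W) = ρ₃ (cst (W e)) := by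
      rw [show ρ₃ (cst (W e)) = ρ₂ (cst (W e)) from rfl, g2]; rfl
    simp only [chooseHalf, PFormula.Holds, Function.comp_apply, hsh]
    change (ρ₃ (bit W) = ρ₃ (cst false) ∧ _) ∨ (ρ₃ (bit W) = ρ₃ (cst true) ∧ _)
    rw [c0, c1, c2, c3, c4, cb]
    cases hW : W e <;> simp [val, hW]
  · intro j hj W r
    have c : ∀ k, k ∈ [0, 1] → ρ₄ (cell k (1 + j) W r) = val k (1 + j) W r := fun k hk =>
      setCells_cell _ _ hk (by omega) (by omega) W r
    have c' : ∀ k, k ∈ [3, 4] → ρ₄ (cell k (1 + j) W r) = val k (1 + j) W r := fun k hk => by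
      rw [s4.cell (by revert hk; fin_cases k <;> simp)]
      exact setCells_cell _ _ hk (by omega) (by omega) W r
    simp only [copyPair, PFormula.Holds, Function.comp_apply, hsh]
    rw [c 0 (by simp), c 1 (by simp), c' 3 (by simp), c' 4 (by simp)]
    simp [val]
  · constructor
    · exact fun t => g2 t
    · exact fun _ => rfl
    · intro j W r hj
      rw [s4.cell (by tauto), s3.cell (by simp)]
      exact s1.cell (by simp) W r
    · intro j W r hj hj'
      rw [hρ₄, setCells_cell _ _ (by simp) hj hj']
      simp [val]
    · intro j W r hj hj'
      rw [hρ₄, setCells_cell _ _ (by simp) hj hj']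
      simp [val]

end Semantics
end Game
end PromiseMC

namespace PromiseMC
namespace Game

variable {n : ℕ} {K : Type} {α : Type}

/-! ### Correctness of the game -/

theorem holds_disj_elems {A : Type*} {X : Type} [Finite X] (φ : X → PFormula (GameVar n K))
    (ρ : GameVar n K → A) : (disj ((elems X).map φ)).Holds ρ ↔
      (∃ x, (φ x).Holds ρ) ∨ ρ (cst false) = ρ (cst true) := by
  rw [holds_disj]
  refine or_congr_left ⟨fun ⟨_, h, h'⟩ => ?_, fun ⟨x, h⟩ => ⟨_, List.mem_map_of_mem (mem_elems x), h⟩⟩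
  obtain ⟨x, -, rfl⟩ := List.mem_map.1 h
  exact ⟨x, h'⟩

section Rounds

variable {A : Type*} {S : ℕ} (f : K → K → K → K)

/-- `k` rounds, followed by the comparison of the current pair. -/
noncomputable def rounds [Finite K] (S k : ℕ) : List (Instr (GameVar n K)) :=
  ((List.range k).flatMap fun _ => round.flatMap (instSection S)) ++
    instSection S (true, overWorlds (localStep f))

theorem rounds_succ [Finite K] (k : ℕ) :
    rounds (n := n) f S (k + 1) = round.flatMap (instSection S) ++ rounds f S k := by
  simp [rounds, List.range_succ_eq_map, List.flatMap_map]

theorem holds_rounds_zero [Finite K] (ρ : GameVar n K → A) : Instr.Holds (rounds f S 0) ρ ↔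
    ∀ j, j < S → ∀ W, (∃ σ τ υ, Codes ρ 0 j W σ ∧ Codes ρ 0 (j + 1) W τ ∧ Codes ρ 0 (j + 2) W υ ∧
      Codes ρ 1 (j + 1) W (f σ τ υ)) ∨ ρ (cst false) = ρ (cst true) := by
  have h := holds_overWorlds (S := S) (localStep f) [] ρ
  rw [List.append_nil] at h
  simp only [rounds, List.range_zero, List.flatMap_nil, List.nil_append, h, Instr.Holds, and_true,
    localStep, holds_disj_elems, PFormula.Holds, holds_isCell, zero_add, Prod.exists]
  simp only [Nat.add_comm 1, Nat.add_comm 2]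
  exact Iff.rfl

/-- The strategy is to give the true array after `2 ^ k` steps in each world. The start `x W`
depends on the world because different worlds continue with different halves. -/
theorem rounds_intro [Finite K] (k : ℕ) (ρ : GameVar n K → A) (x : World n → ℕ → K)
    (hname : ∀ y, ∃ e, ρ (name e) = y) (hx : ∀ W j, j ≤ S + 1 → Codes ρ 0 j W (x W j))
    (hy : ∀ W j, 1 ≤ j → j ≤ S → Codes ρ 1 j W ((automaton f S)^[2 ^ k] (x W) j)) :
    Instr.Holds (rounds f S k) ρ := by
  classical
  induction k generalizing ρ x with
  | zero =>
    rw [holds_rounds_zero]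
    intro j hj W
    refine Or.inl ⟨_, _, _, hx W j (by omega), hx W (j + 1) (by omega), hx W (j + 2) (by omega), ?_⟩
    have := hy W (j + 1) (by omega) (by omega)
    rwa [pow_zero, Function.iterate_one, automaton, if_pos (by omega), Nat.add_sub_cancel] at this
  | succ k ih =>
    rw [rounds_succ]
    set z : World n → ℕ → K := fun W => (automaton f S)^[2 ^ k] (x W) with hz
    refine round_intro (fun j W r => ρ (cst (decide (r = z W j)))) fun y => ?_
    obtain ⟨e, he⟩ := hname y
    refine ⟨e, he, fun ρ' h => ih ρ' (fun W => if W e then z W else x W) ?_ ?_ ?_⟩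
    · intro y
      obtain ⟨e, he⟩ := hname y
      exact ⟨e, by rw [h.name, he]⟩
    · intro W j hj r
      rw [h.cst]
      by_cases hj' : 1 ≤ j ∧ j ≤ S
      · rw [h.first j W r hj'.1 hj'.2]
        split_ifs
        · rfl
        · exact hx W j hj r
      -- The automaton freezes these cells, so the border kept in array `0` is also the correct
      -- border for the second half.
      · rw [h.outside j W r hj', hx W j hj r]
        have : z W j = x W j := by
          have : ∀ t, (automaton f S)^[t] (x W) j = x W j := fun t => by
            induction t with
            | zero => rfl
            | succ t ih => rw [Function.iterate_succ_apply', automaton, if_neg hj', ih]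
          exact this _
        split_ifs
        · rw [this]
        · rfl
    · intro W j hj hj' r
      rw [h.cst, h.second j W r hj hj']
      split_ifs
      · rw [hy W j hj hj' r, hz, ← Function.iterate_add_apply, ← two_mul, ← pow_succ']
      · rfl

/-- In the world formed by the values of the names, the half selected is the challenge itself. Hence
both halves are subject to the induction hypothesis with the same array halfway; nothing is claimed
about the other worlds. -/
theorem rounds_elim [Finite K] (k : ℕ) (ρ : GameVar n K → Bool) (hρ : ∀ t, ρ (cst t) = t) (W : World n)
    (hW : ∀ e, ρ (name e) = W e) (x : ℕ → K) (h : Instr.Holds (rounds f S k) ρ)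
    (hx : ∀ j, j ≤ S + 1 → Codes ρ 0 j W (x j)) (j : ℕ) (hj : 1 ≤ j) (hj' : j ≤ S) :
    Codes ρ 1 j W ((automaton f S)^[2 ^ k] x j) := by
  classical
  have hne : ∀ ρ : GameVar n K → Bool, (∀ t, ρ (cst t) = t) → ρ (cst false) ≠ ρ (cst true) :=
    fun ρ hρ => by rw [hρ, hρ]; decide
  induction k generalizing ρ x j with
  | zero =>
    rw [holds_rounds_zero] at h
    obtain ⟨j, rfl⟩ : ∃ i, j = i + 1 := ⟨j - 1, by omega⟩
    rcases h j (by omega) W with ⟨σ, τ, υ, h1, h2, h3, h4⟩ | h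
    · have e1 := h1.unique (hne ρ hρ) (hx j (by omega))
      have e2 := h2.unique (hne ρ hρ) (hx (j + 1) (by omega))
      have e3 := h3.unique (hne ρ hρ) (hx (j + 2) (by omega))
      rw [pow_zero, Function.iterate_one, automaton, if_pos (by omega), Nat.add_sub_cancel]
      rwa [e1, e2, e3] at h4
    · exact absurd h (hne ρ hρ)
  | succ k ih =>
    rw [rounds_succ] at h
    obtain ⟨z, h⟩ := round_elim (hne ρ hρ) h
    set x' := (automaton f S)^[2 ^ k] x with hx'
    have out : ∀ j, ¬ (1 ≤ j ∧ j ≤ S) → x' j = x j := by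
      intro j hj
      have : ∀ t, (automaton f S)^[t] x j = x j := fun t => by
        induction t with
        | zero => rfl
        | succ t ih => rw [Function.iterate_succ_apply', automaton, if_neg hj, ih]
      exact this _
    -- The challenge `false` selects the first half and forces the array halfway to be the true one.
    have hz : ∀ j r, 1 ≤ j → j ≤ S → z j W r = decide (r = x' j) := by
      intro j r hj hj'
      obtain ⟨e, ρ', he, hs, hI⟩ := h false
      have heW : W e = false := by rw [← hW, he]
      have := ih ρ' (fun t => by rw [hs.cst, hρ]) (fun e => by rw [hs.name, hW]) x hI
        (fun j hj r => by
          rw [hs.cst, ← hx j hj r]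
          by_cases hj' : 1 ≤ j ∧ j ≤ S
          · rw [hs.first j W r hj'.1 hj'.2, heW]; rfl
          · exact hs.outside j W r hj') j hj hj' r
      rwa [hs.second j W r hj hj', heW, hs.cst, hρ] at this
    -- The challenge `true` selects the second half, whose start is now known, and forces the final
    -- array.
    obtain ⟨e, ρ', he, hs, hI⟩ := h true
    have heW : W e = true := by rw [← hW, he]
    have := ih ρ' (fun t => by rw [hs.cst, hρ]) (fun e => by rw [hs.name, hW]) x' hI
      (fun j hj r => by
        rw [hs.cst]
        by_cases hj' : 1 ≤ j ∧ j ≤ S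
        · rw [hs.first j W r hj'.1 hj'.2, heW, if_pos rfl, hz j r hj'.1 hj'.2, hρ]
        · rw [hs.outside j W r hj', out j hj', hx j hj r]) j hj hj'
    intro r
    have := this r
    rwa [hs.second j W r hj hj', heW, if_pos rfl, hs.cst, hx', ← Function.iterate_add_apply,
      ← two_mul, ← pow_succ'] at this

end Rounds

/-! ### The sentence -/

section Sentence

variable (n) (f : K → K → K → K) (x₀ : K) (x₁ x₂ : InSym α → K) (ok : K → Prop)

/-- Only the array indices `0` and `1` are covered here; the next section of `opening` quantifies
the cells `2, …, S + 1`. -/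
noncomputable def initVars [Finite K] : List (GameVar n K) :=
  chal :: ((elems (Fin n)).map name ++ (elems (World n)).map bit ++
    cellVars [0, 1, 2, 3, 4] 0 ++ cellVars [0, 1, 2, 3, 4] 1)

/-- The quantification of all variables, and the border of the first array. -/
noncomputable def opening [Finite K] : List (Bool × List (Instr (GameVar n K))) :=
  [(false, .all (cst false) :: .all (cst true) :: .alt (.eq (cst false) (cst true)) ::
      (initVars n).map .ex),
    (true, (cellVars [0, 1, 2, 3, 4] 2).map .ex),
    (false, overWorlds fun W => isCell 0 0 W x₀)]

/-- The instructions of the sentence for the word `w`. -/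
noncomputable def instrs [Finite K] (S : ℕ) (w : List α) : List (Instr (GameVar n K)) :=
  sentenceInstrs (opening n x₀) (fun a => overWorlds fun W => isCell 0 1 W (x₁ a))
    (fun a => overWorlds fun W => isCell 0 2 W (x₂ a)) [(true, overWorlds (isOneOf ok))] round
    [(true, overWorlds (localStep f))] S w

/-- All variables but the constants. -/
noncomputable def allVars [Finite K] (S : ℕ) : List (GameVar n K) :=
  initVars n ++ (List.range S).flatMap fun j => (cellVars [0, 1, 2, 3, 4] 2).map (shift j)

/-- The part of the sentence after the quantification of all variables. -/
noncomputable def body [Finite K] (S : ℕ) (w : List α) : List (Instr (GameVar n K)) :=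
  (overWorlds fun W => isCell 0 0 W x₀) ++
    ((overWorlds fun W => isCell 0 1 W (x₁ (Transducer.readInput w 1))) ++
      (((List.range S).flatMap fun j => (overWorlds fun W =>
        isCell 0 2 W (x₂ (Transducer.readInput w (j + 2)))).map (Instr.map (shift j))) ++
        (instSection S (true, overWorlds (isOneOf ok)) ++ rounds f S S)))

theorem shift_zero : (shift 0 : GameVar n K → GameVar n K) = id := by
  funext x; rcases x with _ | ⟨_, _⟩ <;> rfl

theorem _root_.PromiseMC.PFormula.map_id {V : Type} (φ : PFormula V) : φ.map id = φ := by
  induction φ with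
  | eq => rfl
  | and φ ψ ih ih' => simp only [PFormula.map, ih, ih']
  | or φ ψ ih ih' => simp only [PFormula.map, ih, ih']

theorem _root_.PromiseMC.Instr.map_id {V : Type} : (Instr.map id : Instr V → Instr V) = id := by
  funext i; cases i <;> simp [Instr.map, PFormula.map_id]

theorem instrs_eq [Finite K] (S : ℕ) (w : List α) : instrs n f x₀ x₁ x₂ ok S w =
    .all (cst false) :: .all (cst true) :: .alt (.eq (cst false) (cst true)) ::
      ((allVars n S).map .ex ++ body n f x₀ x₁ x₂ ok S w) := by
  have h := fun l : List (Instr (GameVar n K)) => show instSection S (false, l) = l by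
    simp [instSection, shift_zero, Instr.map_id]
  simp only [instrs, sentenceInstrs, opening, List.flatMap_cons, List.flatMap_nil, h,
    instSection_ex, allVars, body, rounds, List.map_append, List.append_assoc, List.cons_append,
    List.append_nil]

theorem mem_allVars [Finite K] {S : ℕ} {x : GameVar n K} (h : ∀ t, x ≠ cst t)
    (h' : ∀ j p, x = .inr (j, p) → j ≤ S + 1) : x ∈ allVars n S := by
  have all : ∀ k : Fin 5, k ∈ ([0, 1, 2, 3, 4] : List (Fin 5)) := by decide
  rcases x with (i | e | W) | ⟨j, k, W, r⟩
  · fin_cases i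
    · exact absurd rfl (h false)
    · exact absurd rfl (h true)
    · exact List.mem_append_left _ List.mem_cons_self
  · have : name e ∈ (elems (Fin n)).map (name (K := K)) := List.mem_map_of_mem (mem_elems e)
    simp only [allVars, initVars, List.mem_append, List.mem_cons]
    exact Or.inl (Or.inr (Or.inl (Or.inl (Or.inl this))))
  · have : bit W ∈ (elems (World n)).map (bit (K := K)) := List.mem_map_of_mem (mem_elems W)
    simp only [allVars, initVars, List.mem_append, List.mem_cons]
    exact Or.inl (Or.inr (Or.inl (Or.inl (Or.inr this))))
  · have hj := h' j _ rfl
    have hm : ∀ j, cell k j W r ∈ cellVars [0, 1, 2, 3, 4] j := fun j =>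
      mem_cellVars.2 ⟨k, all k, W, r, rfl⟩
    simp only [allVars, initVars, List.mem_append, List.mem_cons]
    rcases j with _ | _ | j
    · exact Or.inl (Or.inr (Or.inl (Or.inr (hm 0))))
    · exact Or.inl (Or.inr (Or.inr (hm 1)))
    · refine Or.inr (List.mem_flatMap.2 ⟨j, List.mem_range.2 (by omega), ?_⟩)
      have := List.mem_map_of_mem (f := shift j) (hm 2)
      rwa [show shift j (cell k 2 W r) = cell k (j + 1 + 1) W r by
        simp only [shift, cell, Sum.map_inr, Prod.map, id]; rw [Nat.add_comm 2]] at this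

/-! ### Bounds on array indices: the sentence has no free variables. -/

/-- The index of a variable in its array. -/
def arrayIndex : GameVar n K → ℕ
  | .inl _ => 0
  | .inr (j, _) => j

/-- All indices that occur in the formula are at most `m`. -/
def Bounded (m : ℕ) (φ : PFormula (GameVar n K)) : Prop := ∀ x ∈ φ.vars, arrayIndex n x ≤ m

theorem bounded_eq {m : ℕ} {x y : GameVar n K} :
    Bounded n m (.eq x y) ↔ arrayIndex n x ≤ m ∧ arrayIndex n y ≤ m := by
  simp [Bounded, PFormula.vars]

theorem bounded_and {m : ℕ} {φ ψ : PFormula (GameVar n K)} :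
    Bounded n m (.and φ ψ) ↔ Bounded n m φ ∧ Bounded n m ψ := by
  simp [Bounded, PFormula.vars, or_imp, forall_and]

theorem bounded_or {m : ℕ} {φ ψ : PFormula (GameVar n K)} :
    Bounded n m (.or φ ψ) ↔ Bounded n m φ ∧ Bounded n m ψ := by
  simp [Bounded, PFormula.vars, or_imp, forall_and]

theorem bounded_conj {m : ℕ} {l : List (PFormula (GameVar n K))} (h : ∀ φ ∈ l, Bounded n m φ) :
    Bounded n m (conj l) := by
  induction l with
  | nil => exact (bounded_eq n).2 ⟨Nat.zero_le _, Nat.zero_le _⟩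
  | cons φ l ih =>
    rw [List.forall_mem_cons] at h
    exact (bounded_and n).2 ⟨h.1, ih h.2⟩

theorem bounded_disj {m : ℕ} {l : List (PFormula (GameVar n K))} (h : ∀ φ ∈ l, Bounded n m φ) :
    Bounded n m (disj l) := by
  induction l with
  | nil => exact (bounded_eq n).2 ⟨Nat.zero_le _, Nat.zero_le _⟩
  | cons φ l ih =>
    rw [List.forall_mem_cons] at h
    exact (bounded_or n).2 ⟨h.1, ih h.2⟩

theorem bounded_isCell [Finite K] {m : ℕ} (k : Fin 5) {j : ℕ} (hj : j ≤ m) (W : World n) (σ : K) :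
    Bounded n m (isCell k j W σ) := by
  refine bounded_conj n ?_
  simp only [List.forall_mem_map]
  exact fun r _ => (bounded_eq n).2 ⟨hj, Nat.zero_le _⟩

/-- All indices that occur in the instructions are at most `m`. -/
def BoundedInstrs (m : ℕ) (I : List (Instr (GameVar n K))) : Prop :=
  ∀ i ∈ I, ∀ x ∈ i.vars, arrayIndex n x ≤ m

theorem BoundedInstrs.append {m : ℕ} {I J : List (Instr (GameVar n K))} (h : BoundedInstrs n m I)
    (h' : BoundedInstrs n m J) : BoundedInstrs n m (I ++ J) := fun i hi =>
  (List.mem_append.1 hi).elim (h i) (h' i)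

theorem BoundedInstrs.mono {m m' : ℕ} {I : List (Instr (GameVar n K))} (h : BoundedInstrs n m I)
    (hm : m ≤ m') : BoundedInstrs n m' I := fun i hi x hx => (h i hi x hx).trans hm

theorem BoundedInstrs.shift {m : ℕ} {I : List (Instr (GameVar n K))} (h : BoundedInstrs n m I)
    (j : ℕ) : BoundedInstrs n (m + j) (I.map (Instr.map (shift j))) := by
  intro i hi x hx
  obtain ⟨i, hi', rfl⟩ := List.mem_map.1 hi
  rw [Instr.vars_map] at hx
  obtain ⟨x, hx, rfl⟩ := hx
  have := h i hi' x hx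
  rcases x with g | ⟨k, p⟩
  · exact Nat.zero_le _
  · exact Nat.add_le_add_right this j

theorem boundedInstrs_flatMap {X : Type} {m : ℕ} {l : List X} {F : X → List (Instr (GameVar n K))}
    (h : ∀ x ∈ l, BoundedInstrs n m (F x)) : BoundedInstrs n m (l.flatMap F) := by
  intro i hi
  obtain ⟨x, hx, hi⟩ := List.mem_flatMap.1 hi
  exact h x hx i hi

/-- The largest shift is `S - 1`, which takes the index `2` to `S + 1`. -/
theorem BoundedInstrs.section_true {S : ℕ} {I : List (Instr (GameVar n K))}
    (h : BoundedInstrs n 2 I) : BoundedInstrs n (S + 1) (instSection S (true, I)) :=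
  boundedInstrs_flatMap n fun j hj => (h.shift n j).mono n (by
    have := List.mem_range.1 hj; omega)

theorem boundedInstrs_overWorlds {m : ℕ} {φ : World n → PFormula (GameVar n K)}
    (h : ∀ W, Bounded n m (φ W)) : BoundedInstrs n m (overWorlds φ) := by
  simp only [BoundedInstrs, overWorlds, List.forall_mem_map]
  exact fun W _ => h W

theorem boundedInstrs_overBits [Finite K] {m : ℕ} {φ : World n → K → PFormula (GameVar n K)}
    (h : ∀ W r, Bounded n m (φ W r)) : BoundedInstrs n m (overBits φ) := by
  simp only [BoundedInstrs, overBits, List.forall_mem_map]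
  exact fun p _ => h p.1 p.2

theorem boundedInstrs_cellVars [Finite K] {m : ℕ} (ks : List (Fin 5)) {j : ℕ} (hj : j ≤ m) :
    BoundedInstrs n m ((cellVars (n := n) (K := K) ks j).map .ex) := by
  intro i hi x hx
  obtain ⟨y, hy, rfl⟩ := List.mem_map.1 hi
  obtain ⟨k, -, W, r, rfl⟩ := mem_cellVars.1 hy
  obtain rfl := Set.mem_singleton_iff.1 hx
  exact hj

theorem boundedInstrs_round [Finite K] (S : ℕ) :
    BoundedInstrs n (S + 1) ((round (n := n) (K := K)).flatMap (instSection S)) := by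
  refine boundedInstrs_flatMap n ?_
  simp only [round, List.forall_mem_cons]
  refine ⟨?_, ?_, ?_, ?_, ?_, ?_, by simp⟩
  · exact (boundedInstrs_cellVars n _ (by norm_num)).section_true n
  · have h : BoundedInstrs n 0 (Instr.all (chal (n := n) (K := K)) ::
        (((elems (World n)).map bit).map .ex ++ [.assert challenge])) := by
      simp only [BoundedInstrs, List.forall_mem_cons, List.forall_mem_append, List.forall_mem_map]
      refine ⟨?_, ?_, ?_, by simp⟩
      · rintro x rfl; exact le_rfl
      · rintro W _ x rfl; exact le_rfl
      · refine bounded_disj n ?_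
        simp only [List.forall_mem_map]
        refine fun e _ => (bounded_and n).2 ⟨(bounded_eq n).2 ⟨le_rfl, le_rfl⟩, bounded_conj n ?_⟩
        simp only [List.forall_mem_map]
        exact fun W _ => (bounded_eq n).2 ⟨le_rfl, le_rfl⟩
    exact (h.shift n 0).mono n (by omega)
  · exact (boundedInstrs_cellVars n _ (by norm_num)).section_true n
  · refine (boundedInstrs_overBits n fun W r => ?_).section_true n
    simp [chooseHalf, bounded_or, bounded_and, bounded_eq, arrayIndex, bit, cst, cell]
  · exact (boundedInstrs_cellVars n _ (by norm_num)).section_true n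
  · refine (boundedInstrs_overBits n fun W r => ?_).section_true n
    simp [copyPair, bounded_and, bounded_eq, arrayIndex, cell]

theorem boundedInstrs_body [Finite K] (S : ℕ) (w : List α) :
    BoundedInstrs n (S + 1) (body n f x₀ x₁ x₂ ok S w) := by
  refine .append n ?_ (.append n ?_ (.append n ?_ (.append n ?_ (.append n ?_ ?_))))
  · exact boundedInstrs_overWorlds n fun W => bounded_isCell n _ (by omega) _ _
  · exact boundedInstrs_overWorlds n fun W => bounded_isCell n _ (by omega) _ _
  · refine boundedInstrs_flatMap n fun j hj => ((boundedInstrs_overWorlds n fun W =>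
      bounded_isCell n _ le_rfl _ _).shift n j).mono n ?_
    have := List.mem_range.1 hj
    omega
  · refine (boundedInstrs_overWorlds n fun W => bounded_disj n ?_).section_true n
    simp only [List.forall_mem_map]
    exact fun σ _ => bounded_isCell n _ (by norm_num) _ _
  · exact boundedInstrs_flatMap n fun _ _ => boundedInstrs_round n S
  · refine (boundedInstrs_overWorlds n fun W => bounded_disj n ?_).section_true n
    simp only [List.forall_mem_map]
    exact fun p _ => (bounded_and n).2 ⟨bounded_isCell n _ (by norm_num) _ _,
      (bounded_and n).2 ⟨bounded_isCell n _ (by norm_num) _ _,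
        (bounded_and n).2 ⟨bounded_isCell n _ le_rfl _ _, bounded_isCell n _ (by norm_num) _ _⟩⟩⟩

theorem isSentence_instrs [Finite K] (S : ℕ) (w : List α) :
    (Instr.toFormula varNum (cst false) (instrs n f x₀ x₁ x₂ ok S w)).IsSentence := by
  rw [instrs_eq]
  refine Instr.isSentence_toFormula _ _ _ _ _ fun i hi x hx => ?_
  by_cases h0 : x = cst false
  · exact Or.inl h0
  by_cases h1 : x = cst true
  · exact Or.inr (Or.inl h1)
  refine Or.inr (Or.inr (mem_allVars n (fun t => by cases t <;> assumption) ?_))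
  rintro j p rfl
  exact boundedInstrs_body n f x₀ x₁ x₂ ok S w i hi _ hx

/-! ### Truth of the sentence and the final array of the automaton. -/

variable {n}

theorem holds_body [Finite K] {A : Type*} (S : ℕ) (w : List α) (ρ : GameVar n K → A) :
    Instr.Holds (body n f x₀ x₁ x₂ ok S w) ρ ↔
      (∀ W, Codes ρ 0 0 W x₀) ∧ (∀ W, Codes ρ 0 1 W (x₁ (Transducer.readInput w 1))) ∧
        (∀ j, j < S → ∀ W, Codes ρ 0 (j + 2) W (x₂ (Transducer.readInput w (j + 2)))) ∧
        (∀ j, j < S → ∀ W, (∃ σ, ok σ ∧ Codes ρ 1 (j + 1) W σ) ∨ ρ (cst false) = ρ (cst true)) ∧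
        Instr.Holds (rounds f S S) ρ := by
  have hc : ∀ k j W (σ : K), (isCell k j W σ).Holds ρ ↔ Codes ρ k j W σ := fun k j W σ => by
    have := holds_isCell ρ 0 k j W σ
    rwa [shift_zero] at this
  have hl : ((List.range S).flatMap fun j => (overWorlds fun W =>
        isCell 0 2 W (x₂ (Transducer.readInput w (j + 2)))).map (Instr.map (shift j))) =
      ((List.range S).flatMap fun j => (elems (World n)).map fun W =>
        (isCell 0 2 W (x₂ (Transducer.readInput w (j + 2)))).map (shift j)).map .assert := by
    simp only [overWorlds, List.map_flatMap, List.map_map]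
    rfl
  rw [body, overWorlds, Instr.holds_asserts, overWorlds, Instr.holds_asserts, hl,
    Instr.holds_asserts, holds_overWorlds]
  have hm : ∀ φ : ℕ → World n → PFormula (GameVar n K),
      (∀ ψ ∈ (List.range S).flatMap fun j => (elems (World n)).map (φ j), ψ.Holds ρ) ↔
        ∀ j, j < S → ∀ W, (φ j W).Holds ρ := fun φ => by
    simp only [List.forall_mem_flatMap, List.forall_mem_map, List.mem_range, mem_elems, forall_const]
  rw [hm]
  simp only [List.forall_mem_map, mem_elems, forall_const, hc, PFormula.holds_map, holds_isCell,
    isOneOf, holds_disj_elems, Subtype.exists, exists_prop]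
  simp only [Nat.add_comm 1, Nat.add_comm 2]
  rfl

/-- If the run of the automaton leads to an array with good cells only, then the sentence holds in
every set with at most `n` elements. -/
theorem holds_instrs_of_good [Finite K] {A : Type*} (g : Fin n → A) (hg : Function.Surjective g) (S : ℕ)
    (w : List α) (x : ℕ → K) (hx₀ : x 0 = x₀) (hx₁ : x 1 = x₁ (Transducer.readInput w 1))
    (hx₂ : ∀ j, x (j + 2) = x₂ (Transducer.readInput w (j + 2)))
    (h : ∀ j, 1 ≤ j → j ≤ S → ok ((automaton f S)^[2 ^ S] x j)) (ρ : GameVar n K → A) :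
    Instr.Holds (instrs n f x₀ x₁ x₂ ok S w) ρ := by
  classical
  rw [instrs_eq]
  intro a b
  -- The strategy below works even if the two constants have the same value.
  refine Or.inr ?_
  set ρ₀ := Function.update (Function.update ρ (cst false) a) (cst true) b with hρ₀
  -- Array `0` starts with the initial cells and array `1` with the final ones; the values of the
  -- other arrays are irrelevant.
  let y : Fin 5 → ℕ → K := fun k => if k = 0 then x else (automaton f S)^[2 ^ S] x
  let ρ' : GameVar n K → A := fun v => match v with
    | .inl (.inr (.inl e)) => g e
    | .inr (j, k, W, r) => if j ≤ S + 1 then ρ₀ (cst (decide (r = y k j))) else ρ₀ (.inr (j, k, W, r))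
    | v => ρ₀ v
  have hcst : ∀ t, ρ' (cst t) = ρ₀ (cst t) := fun t => rfl
  have hcode : ∀ k j W, j ≤ S + 1 → Codes ρ' k j W (y k j) := fun k j W hj r => by
    rw [hcst]; exact if_pos hj
  rw [Instr.holds_exs]
  refine ⟨ρ', fun v hv => ?_, ?_⟩
  · rcases v with (i | e | W) | ⟨j, k, W, r⟩
    · rfl
    · exact absurd (mem_allVars n (fun t => by simp [cst]) (by simp)) hv
    · rfl
    · refine if_neg fun hj => hv (mem_allVars n (fun t => by simp [cst]) ?_)
      rintro j' p he
      simp only [Sum.inr.injEq, Prod.mk.injEq] at he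
      omega
  · rw [holds_body]
    refine ⟨fun W => ?_, fun W => ?_, fun j hj W => ?_, fun j hj W => Or.inl ?_, ?_⟩
    · rw [← hx₀]; exact hcode 0 0 W (by omega)
    · rw [← hx₁]; exact hcode 0 1 W (by omega)
    · rw [← hx₂]; exact hcode 0 (j + 2) W (by omega)
    · exact ⟨_, h (j + 1) (by omega) (by omega), hcode 1 (j + 1) W (by omega)⟩
    · exact rounds_intro f S ρ' (fun _ => x) hg (fun W j hj => hcode 0 j W hj)
        fun W j _ hj => hcode 1 j W (by omega)

/-- If the sentence holds in the set with two elements, then the run of the automaton leads to an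
array with good cells only. -/
theorem good_of_holds_instrs [Finite K] (S : ℕ) (w : List α) (x : ℕ → K) (hx₀ : x 0 = x₀)
    (hx₁ : x 1 = x₁ (Transducer.readInput w 1))
    (hx₂ : ∀ j, x (j + 2) = x₂ (Transducer.readInput w (j + 2))) (ρ : GameVar n K → Bool)
    (h : Instr.Holds (instrs n f x₀ x₁ x₂ ok S w) ρ) (j : ℕ) (hj : 1 ≤ j) (hj' : j ≤ S) :
    ok ((automaton f S)^[2 ^ S] x j) := by
  classical
  rw [instrs_eq] at h
  -- With these values of the constants, the alternative that they are equal fails and each bit is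
  -- represented by itself.
  have h := h false true
  set ρ₀ := Function.update (Function.update ρ (cst false) false) (cst true) true with hρ₀
  have h0 : ∀ t, ρ₀ (cst t) = t := by
    intro t
    cases t
    · rw [hρ₀, Function.update_of_ne (by simp [cst]), Function.update_self]
    · rw [hρ₀, Function.update_self]
  have hne : ∀ t, (cst t : GameVar n K) ∉ allVars n S := by
    intro t ht
    simp only [allVars, initVars, List.mem_append, List.mem_cons, List.mem_map, List.mem_flatMap,
      mem_cellVars] at ht
    rcases ht with (h | ((⟨_, _, h⟩ | ⟨_, _, h⟩) | ⟨_, _, _, _, h⟩) | ⟨_, _, _, _, h⟩) |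
      ⟨_, _, _, ⟨_, _, _, _, rfl⟩, h⟩
    · cases t <;> simp [cst, chal] at h
    all_goals simp [cst, name, bit, cell, shift] at h
  rcases h with h | h
  · have h : ρ₀ (cst false) = ρ₀ (cst true) := h
    rw [h0, h0] at h
    cases h
  rw [Instr.holds_exs] at h
  obtain ⟨ρ', hρ', h⟩ := h
  have h1 : ∀ t, ρ' (cst t) = t := fun t => by rw [hρ' _ (hne t), h0]
  rw [holds_body] at h
  obtain ⟨c0, c1, c2, cok, hr⟩ := h
  -- The decisive world consists of the values that were chosen for the names.
  have hcodes := rounds_elim f S ρ' h1 (fun e => ρ' (name e)) (fun _ => rfl) x hr (fun j hj => by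
    rcases j with _ | _ | j
    · rw [hx₀]; exact c0 _
    · rw [zero_add, hx₁]; exact c1 _
    · rw [hx₂ j]; exact c2 j (by omega) _) j hj hj'
  have hne' : ρ' (cst false) ≠ ρ' (cst true) := by rw [h1, h1]; decide
  obtain ⟨j, rfl⟩ : ∃ i, j = i + 1 := ⟨j - 1, by omega⟩
  rcases cok j (by omega) fun e => ρ' (name e) with ⟨σ, hσ, h⟩ | h
  · rwa [hcodes.unique hne' h]
  · exact absurd h hne'

end Sentence
end Game
end PromiseMC

namespace PromiseMC

/-! ### Hardness -/

/-- With `c` the sum of the coefficients and `d` the degree, one factor of the power absorbs `k * c`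
and the remaining ones absorb `(m + 1) ^ d`. -/
theorem exists_eval_le_pow (p : Polynomial ℕ) (k : ℕ) :
    ∃ C, 0 < C ∧ ∀ m, k * p.eval m ≤ (m + 1 + C) ^ C := by
  obtain ⟨c, d, h⟩ : ∃ c d, ∀ m, p.eval m ≤ c * (m + 1) ^ d := by
    refine ⟨p.sum fun _ a => a, p.natDegree, fun m => ?_⟩
    rw [Polynomial.eval_eq_sum, Polynomial.sum, Polynomial.sum, Finset.sum_mul]
    refine Finset.sum_le_sum fun i hi => Nat.mul_le_mul_left _ ?_
    exact (Nat.pow_le_pow_left (Nat.le_succ m) i).trans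
      (Nat.pow_le_pow_right (Nat.succ_pos m) (Polynomial.le_natDegree_of_mem_supp i hi))
  refine ⟨k * c + d + 1, Nat.succ_pos _, fun m => ?_⟩
  calc k * p.eval m ≤ k * (c * (m + 1) ^ d) := Nat.mul_le_mul_left _ (h m)
    _ = (k * c) * (m + 1) ^ d := by ring
    _ ≤ (m + 1 + (k * c + d + 1)) * (m + 1 + (k * c + d + 1)) ^ (k * c + d) := by
      refine Nat.mul_le_mul (by omega) ?_
      exact (Nat.pow_le_pow_left (by omega) d).trans (Nat.pow_le_pow_right (by omega) (by omega))
    _ = _ := by rw [← pow_succ']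

namespace TM

variable {α : Type} (M : TM α)

/-- The tape symbol for an input symbol. -/
def tapeSymbol : InSym α → M.Γ
  | .letter a => M.inp a
  | _ => M.blank

/-- The left end marker shifts the input tape by one, and the right end marker stands for all blanks
behind the word. -/
theorem tape_init (w : List α) (j : ℕ) :
    (M.init w).tape j = M.tapeSymbol (Transducer.readInput w (j + 1)) := by
  simp only [TM.init, Transducer.readInput]
  cases w[j]? <;> rfl

theorem cells_init_one (w : List α) :
    M.cells (M.init w) 1 = some (M.tapeSymbol (Transducer.readInput w 1), some M.start) := by
  simp only [cells, tape_init]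
  simp [TM.init]

theorem cells_init_add_two (w : List α) (j : ℕ) :
    M.cells (M.init w) (j + 2) = some (M.tapeSymbol (Transducer.readInput w (j + 2)), none) := by
  simp only [cells, tape_init]
  simp [TM.init]

end TM

/-- The two sides are argued in different structures: members give truth in `A`, with as many names
as elements, and truth in `B` is transferred to `Bool`, where it implies membership. -/
theorem pspaceHard_PMC_eq {A B : Type*} [Finite A] (hB : ∃ f : B → Bool, Function.Surjective f) :
    (PMC eqLang A B).PSPACEHard := by
  rintro α _ L ⟨M, p, hL, hp⟩
  have := M.finQ
  have := M.finΓ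
  obtain ⟨C, hC, hpC⟩ := exists_eval_le_pow p (Nat.card (M.Γ × Option M.Q))
  let n := Nat.card A
  let x₁ : InSym α → M.Cell := fun a => some (M.tapeSymbol a, some M.start)
  let x₂ : InSym α → M.Cell := fun a => some (M.tapeSymbol a, none)
  let I : List α → List (Instr (GameVar n M.Cell)) := fun w =>
    Game.instrs n M.localRule none x₁ x₂ M.Fine ((w.length + 1 + C) ^ C) w
  let φ : List α → Formula eqLang := fun w => Instr.toFormula varNum (Game.cst false) (I w)
  have hφ : ∀ w, (φ w).IsSentence := fun w => Game.isSentence_instrs n _ _ _ _ _ _ w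
  refine ⟨fun w => (φ w).encode, ?_, fun w => ⟨fun hw => ⟨φ w, hφ w, fun ε => ?_, rfl⟩,
    fun hw => ⟨φ w, hφ w, fun h => hw ?_, rfl⟩⟩⟩
  · exact logspaceComputable_sentenceInstrs C hC _ _ _ _ _ _ _
  · rw [Instr.holds_toFormula _ varNum_injective]
    refine Game.holds_instrs_of_good _ _ _ _ _ (Finite.equivFin A).symm
      (Finite.equivFin A).symm.surjective _ w (M.cells (M.init w)) rfl (M.cells_init_one w)
      (M.cells_init_add_two w) ?_ _
    exact (M.mem_iff_fine hL hp w _ (hpC _)).1 hw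
  · obtain ⟨f, hf⟩ := hB
    have h := h.of_surjective f hf fun _ => false
    rw [Instr.holds_toFormula _ varNum_injective] at h
    exact (M.mem_iff_fine hL hp w _ (hpC _)).2 (Game.good_of_holds_instrs _ _ _ _ _ _ w
      (M.cells (M.init w)) rfl (M.cells_init_one w) (M.cells_init_add_two w) _ h)

theorem exists_surjective_of_card_le {A B : Type*} [Finite A] [Finite B] [Nonempty B]
    (h : Nat.card B ≤ Nat.card A) : ∃ f : A → B, Function.Surjective f := by
  have := Fintype.ofFinite A
  have := Fintype.ofFinite B
  rw [Nat.card_eq_fintype_card, Nat.card_eq_fintype_card] at h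
  obtain ⟨g⟩ := Function.Embedding.nonempty_of_card_le h
  exact ⟨Function.invFun g, Function.invFun_surjective g.injective⟩

end PromiseMC

theorem mainTheorem6 {A B : Type*} [Finite A] [Finite B]
    (hB : 2 ≤ Nat.card B) (hAB : Nat.card B ≤ Nat.card A) :
    PromiseMC.IsTemplate PromiseMC.eqLang A B ∧
      (PromiseMC.PMC PromiseMC.eqLang A B).PSPACEHard := by
  have : Nonempty B := (Nat.card_pos_iff.1 (by omega)).1
  refine ⟨fun φ _ h => ?_, PromiseMC.pspaceHard_PMC_eq ?_⟩
  · obtain ⟨f, hf⟩ := PromiseMC.exists_surjective_of_card_le hAB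
    exact h.of_surjective f hf
  · exact PromiseMC.exists_surjective_of_card_le (by simpa using hB)
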